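/- For an even integer $k\ge 4$ and $z$ in the upper half-plane $\mathbb{H}=\{z\in\mathbb{C}:\operatorname{Im}(z)>0\}$, let $$E_k(z)=\frac12\sum_{\substack{(c,d)\in\mathbb{Z}^2\\ \gcd(c,d)=1}}(cz+d)^{-k},\qquad E^*_{k,3}(z)=\frac{3^{k/2}E_k(3z)+E_k(z)}{3^{k/2}+1},$$ and let $$\mathbb{F}^*(3)=\Big\{z\in\mathbb{H}: |z|\ge \tfrac1{\sqrt3},\ -\tfrac12\le \operatorname{Re}(z)\le 0\Big\}\cup\Big\{z\in\mathbb{H}: |z|>\tfrac1{\sqrt3},\ 0\le \operatorname{Re}(z)<\tfrac12\Big\},$$ a fundamental domain for the Fricke group $\Gamma_0^*(3)$. Theorem. For every even integer $k\ge 4$, all zeros of $E^*_{k,3}$ in $\mathbb{F}^*(3)$ lie on the closed arc $\{z\in\mathbb{C}: |z|=1/\sqrt3,\ \pi/2\le\arg z\le 5\pi/6\}$. -/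

import Mathlib

open UpperHalfPlane

noncomputable section

/-- The Eisenstein series of weight `k` associated with the Fricke group `Γ₀*(p)`,
`E*_{k,p}(z) = (p^{k/2} E_k(p z) + E_k(z)) / (p^{k/2} + 1)`, for even `k ≥ 4`. Here
`ModularForm.E` is `E_k(z) = (1/2) ∑_{(c,d)=1} (c z + d)^{-k}`, and `k / 2` is division of
natural numbers, which is exact for even `k`. -/
def frickeEisenstein (p : ℕ) [NeZero p] (k : ℕ) (hk : 4 ≤ k) (z : ℍ) : ℂ :=
  ((p : ℂ) ^ (k / 2) *
      ModularForm.E (k := k) (by omega)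
        ((⟨(p : ℝ), Nat.cast_pos.mpr (NeZero.pos p)⟩ : {x : ℝ // 0 < x}) • z) +
    ModularForm.E (k := k) (by omega) z) / ((p : ℂ) ^ (k / 2) + 1)

/-- The fundamental domain `𝔽*(3)` of the Fricke group `Γ₀*(3)` in the upper half-plane. -/
def frickeDomainThree : Set ℍ :=
  {z : ℍ | 1 / √3 ≤ ‖(z : ℂ)‖ ∧ -(1 / 2) ≤ z.re ∧ z.re ≤ 0} ∪
    {z : ℍ | 1 / √3 < ‖(z : ℂ)‖ ∧ 0 ≤ z.re ∧ z.re < 1 / 2}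

/-- The closed arc `|z| = 1/√3`, `π/2 ≤ arg z ≤ 5π/6`. -/
def frickeClosedArcThree : Set ℂ :=
  {z : ℂ | ‖z‖ = 1 / √3 ∧ Real.pi / 2 ≤ z.arg ∧ z.arg ≤ 5 * Real.pi / 6}

end

open ComplexConjugate

/-! Put `s = √3 z` and `k = 2m`. Then `E*` is half the sum over admissible `(a, b)` of `(√3 a s +
b)⁻ᵏ + (b s + √3 a)⁻ᵏ`, which treats the two cusp-type forms symmetrically. It has to be shown that
this sum has no zero with `|s| > 1` over the strip. The reflection `s ↦ -s̄` reduces this to the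
left half, described by `e = |s|² - 1 > 0` and `τ = 3 + 2√3 Re s ∈ [0, 3]`. The corner `ρ =
e^{5πi/6}` is `e = τ = 0`. On that half all forms satisfy `|form|² ≥ 3a² - 3|ab| + b²`, whose values
on admissible pairs are `1` or at least `7`.

Near the corner several terms have modulus close to one and triangle inequalities fail. There the
disc coordinate `w = (s - ρ)/(s - ρ̄)` is used. The values of the forms at `ρ` are permuted by the
twelfth roots of unity, so averaging kills every Taylor coefficient in `w` except those of `wⁱ` with
`6 ∣ m + i`. The first surviving term, possibly a forced zero at `w = 0`, dominates all the others
(`frickeSum_ne_zero_of_orbitCoeff`, `frickeSum_ne_zero_of_coeffRatio`).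

Away from the corner but well above the arc, the term `1` beats the sum of the absolute values of
all the rest (`frickeSum_ne_zero_of_remainderBound`). Close to the arc the main part is `1 + s⁻ᵏ`,
which can vanish on it. After multiplication by `sᵐ` the whole series is real on `|s| = 1`, so the
imaginary part of every summand carries a factor `R - R⁻¹` with `R = |s|ᵐ`. This factor cancels
against the one in `Im (sᵐ + s⁻ᵐ)`. At a zero, `Im sᵐ` and `Re sᵐ` would both be too small for `|sᵐ|
= R` (`frickeSum_ne_zero_of_imRemainderBound`).

All bounds improve with `m` when `m e` and `m τ` are held fixed, so finitely many numerical checks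
at `m = 3` and `m = 4` suffice. In weight four the corner expansion reaches up to `Im s = 6/5`, and
the `q`-expansion covers the rest. -/

/-! ### The Fricke Eisenstein series as a symmetrised lattice sum. -/

/-- Coprime pairs `(a, b)` with `3 ∤ b`. -/
def admissiblePairs : Set (ℤ × ℤ) := {p | IsCoprime p.1 p.2 ∧ ¬ (3 : ℤ) ∣ p.2}

/-- The linear form `√3 a s + b`. -/
noncomputable def linForm (s : ℂ) (p : ℤ × ℤ) : ℂ := ((√3 : ℝ) : ℂ) * p.1 * s + p.2

/-- The dual linear form `b s + √3 a`. -/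
noncomputable def dualForm (s : ℂ) (p : ℤ × ℤ) : ℂ := p.2 * s + ((√3 : ℝ) : ℂ) * p.1

/-- The symmetrised summand at the pair `p`. -/
noncomputable def frickeTerm (k : ℕ) (s : ℂ) (p : ℤ × ℤ) : ℂ :=
  (linForm s p ^ k)⁻¹ + (dualForm s p ^ k)⁻¹

/-- Twice the Fricke Eisenstein series of level three, in the variable `s = √3 z`. -/
noncomputable def frickeSum (k : ℕ) (s : ℂ) : ℂ :=
  ∑' p : ℤ × ℤ, admissiblePairs.indicator (frickeTerm k s) p

lemma summable_inv_pow_form {k : ℕ} (hk : 3 ≤ k) (z : ℍ) :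
    Summable fun p : ℤ × ℤ => (((p.1 : ℂ) * z + p.2) ^ k)⁻¹ := by
  refine (summable_prod_eisSummand hk z).congr fun p => ?_
  simp [EisensteinSeries.eisSummand]

lemma eisenstein_eq_tsum_coprime {k : ℕ} (hk : 3 ≤ k) (z : ℍ) :
    ModularForm.E hk z = (1 / 2 : ℂ) * ∑' p : ℤ × ℤ,
      {p : ℤ × ℤ | IsCoprime p.1 p.2}.indicator
        (fun p => (((p.1 : ℂ) * z + p.2) ^ k)⁻¹) p := by
  rw [show ModularForm.E hk z =
    (1 / 2 : ℂ) • EisensteinSeries.eisensteinSeriesSIF (N := 1) 0 k z from rfl,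
    EisensteinSeries.eisensteinSeriesSIF_apply 0 k z, eisensteinSeries, smul_eq_mul]
  congr 1
  rw [tsum_subtype (EisensteinSeries.gammaSet 1 1 0) (fun v => EisensteinSeries.eisSummand k v z),
    ← (finTwoArrowEquiv ℤ).symm.tsum_eq]
  refine tsum_congr fun p => ?_
  have h : ((finTwoArrowEquiv ℤ).symm p ∈ EisensteinSeries.gammaSet 1 1 0) ↔
      p ∈ {p : ℤ × ℤ | IsCoprime p.1 p.2} := by
    rw [EisensteinSeries.mem_gammaSet_one]; simp
  by_cases hp : p ∈ {p : ℤ × ℤ | IsCoprime p.1 p.2}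
  · rw [Set.indicator_of_mem hp, Set.indicator_of_mem (h.2 hp)]
    simp [EisensteinSeries.eisSummand]
  · rw [Set.indicator_of_notMem hp, Set.indicator_of_notMem (mt h.1 hp)]

lemma indicator_apply_congr {S T : Set (ℤ × ℤ)} {f g : ℤ × ℤ → ℂ} {p q : ℤ × ℤ}
    (h : p ∈ S ↔ q ∈ T) (hfg : f p = g q) : S.indicator f p = T.indicator g q := by
  by_cases hp : p ∈ S
  · rw [Set.indicator_of_mem hp, Set.indicator_of_mem (h.1 hp), hfg]
  · rw [Set.indicator_of_notMem hp, Set.indicator_of_notMem (mt h.2 hp)]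

lemma isCoprime_three_iff (n : ℤ) : IsCoprime 3 n ↔ ¬ (3 : ℤ) ∣ n :=
  (Int.prime_three.coprime_iff_not_dvd)

/-- Split by whether 3 divides the first entry. If not, swapping the entries gives an admissible
pair. If so, the entry is `3a`, and coprimality of `(3a, b)` is exactly admissibility of `(a, b)`.
-/
lemma tsum_coprime_eq_left {f : ℤ × ℤ → ℂ} (hf : Summable f) :
    ∑' p : ℤ × ℤ, {p : ℤ × ℤ | IsCoprime p.1 p.2}.indicator f p =
      ∑' p : ℤ × ℤ, admissiblePairs.indicator (fun p => f (p.2, p.1)) p +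
      ∑' p : ℤ × ℤ, admissiblePairs.indicator (fun p => f (3 * p.1, p.2)) p := by
  have hsplit : ∀ p : ℤ × ℤ, {p : ℤ × ℤ | IsCoprime p.1 p.2}.indicator f p =
      {p : ℤ × ℤ | IsCoprime p.1 p.2 ∧ ¬ (3 : ℤ) ∣ p.1}.indicator f p +
      {p : ℤ × ℤ | IsCoprime p.1 p.2 ∧ (3 : ℤ) ∣ p.1}.indicator f p := by
    intro p
    simp only [Set.indicator, Set.mem_ofPred_eq]
    by_cases h1 : IsCoprime p.1 p.2 <;> by_cases h2 : (3 : ℤ) ∣ p.1 <;> simp [h1, h2]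
  rw [tsum_congr hsplit, (hf.indicator _).tsum_add (hf.indicator _)]
  congr 1
  · rw [← (Equiv.prodComm ℤ ℤ).tsum_eq]
    refine tsum_congr fun p => ?_
    exact indicator_apply_congr (by simp [admissiblePairs, isCoprime_comm]) rfl
  · have hinj : Function.Injective (fun p : ℤ × ℤ => (3 * p.1, p.2)) := by
      rintro ⟨a, b⟩ ⟨c, d⟩ h
      simp only [Prod.mk.injEq] at h ⊢
      omega
    rw [← hinj.tsum_eq]
    · refine tsum_congr fun p => ?_
      exact indicator_apply_congr (by simp [admissiblePairs, IsCoprime.mul_left_iff,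
        isCoprime_three_iff, and_comm]) rfl
    · intro p hp
      have hp' := Set.mem_of_indicator_ne_zero hp
      obtain ⟨c, hc⟩ := hp'.2
      exact ⟨(c, p.2), by simp [← hc]⟩

lemma frickeTerm_eq {m : ℕ} (z : ℂ) (p : ℤ × ℤ) :
    frickeTerm (2 * m) ((√3 : ℝ) * z) p = (((3 * p.1 : ℂ) * z + p.2) ^ (2 * m))⁻¹ +
      ((3 : ℂ) ^ m)⁻¹ * (((p.2 : ℂ) * z + p.1) ^ (2 * m))⁻¹ := by
  have h3 : ((√3 : ℝ) : ℂ) ^ 2 = 3 := by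
    rw [← Complex.ofReal_pow, Real.sq_sqrt (by norm_num)]; norm_num
  have h1 : linForm ((√3 : ℝ) * z) p = (3 * p.1 : ℂ) * z + p.2 := by
    rw [linForm]; linear_combination (p.1 : ℂ) * z * h3
  have h2 : dualForm ((√3 : ℝ) * z) p = ((√3 : ℝ) : ℂ) * ((p.2 : ℂ) * z + p.1) := by
    rw [dualForm]; ring
  rw [frickeTerm, h1, h2, mul_pow, pow_mul ((√3 : ℝ) : ℂ), h3, mul_inv]

lemma summable_shift_left {k : ℕ} (hk : 3 ≤ k) (z : ℍ) :
    Summable fun p : ℤ × ℤ => (((3 * p.1 : ℂ) * z + p.2) ^ k)⁻¹ := by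
  have hinj : Function.Injective (fun p : ℤ × ℤ => (3 * p.1, p.2)) := by
    rintro ⟨a, b⟩ ⟨c, d⟩ h
    simp only [Prod.mk.injEq] at h ⊢
    omega
  refine ((summable_inv_pow_form hk z).comp_injective hinj).congr fun p => ?_
  simp

lemma summable_swap {k : ℕ} (hk : 3 ≤ k) (z : ℍ) :
    Summable fun p : ℤ × ℤ => (((p.2 : ℂ) * z + p.1) ^ k)⁻¹ :=
  ((summable_inv_pow_form hk z).comp_injective (Equiv.prodComm ℤ ℤ).injective).congr
    fun p => by simp

lemma summable_frickeTerm {m : ℕ} (hm : 2 ≤ m) (z : ℍ) :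
    Summable (frickeTerm (2 * m) ((√3 : ℝ) * z)) := by
  refine ((summable_shift_left (k := 2 * m) (by omega) z).add
    ((summable_swap (k := 2 * m) (by omega) z).mul_left ((3 : ℂ) ^ m)⁻¹)).congr fun p => ?_
  rw [frickeTerm_eq]

/-- With the two half-sums `A` and `B` below, `2 E(z) = A + B` and `2 E(3z) = A + 3⁻²ᵐ B`. In `3ᵐ
E(3z) + E(z)` the normalising factor `3ᵐ + 1` then comes out and leaves `A + 3⁻ᵐ B`. -/
theorem frickeEisenstein_eq_frickeSum {m : ℕ} (hm : 4 ≤ 2 * m) (z : ℍ) :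
    frickeEisenstein 3 (2 * m) hm z = (1 / 2 : ℂ) * frickeSum (2 * m) ((√3 : ℝ) * z) := by
  have hk : 3 ≤ 2 * m := by omega
  set A := ∑' p : ℤ × ℤ, admissiblePairs.indicator
    (fun p => (((3 * p.1 : ℂ) * z + p.2) ^ (2 * m))⁻¹) p with hA
  set B := ∑' p : ℤ × ℤ, admissiblePairs.indicator
    (fun p => (((p.2 : ℂ) * z + p.1) ^ (2 * m))⁻¹) p with hB
  have hF : frickeSum (2 * m) ((√3 : ℝ) * z) = A + ((3 : ℂ) ^ m)⁻¹ * B := by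
    rw [hA, hB, ← tsum_mul_left, ← Summable.tsum_add
      ((summable_shift_left hk z).indicator _) (((summable_swap hk z).indicator _).mul_left _)]
    refine tsum_congr fun p => ?_
    by_cases hp : p ∈ admissiblePairs
    · simp only [Set.indicator_of_mem hp, frickeTerm_eq]
    · simp only [Set.indicator_of_notMem hp, mul_zero, add_zero]
  have hE1 : ModularForm.E hk z = (1 / 2 : ℂ) * (B + A) := by
    rw [eisenstein_eq_tsum_coprime hk, tsum_coprime_eq_left (summable_inv_pow_form hk z)]
    congr 2
    refine tsum_congr fun p => ?_
    simp
  have hE3 : ModularForm.E hk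
      ((⟨((3 : ℕ) : ℝ), Nat.cast_pos.mpr (NeZero.pos 3)⟩ : {x : ℝ // 0 < x}) • z) =
      (1 / 2 : ℂ) * (A + ((3 : ℂ) ^ (2 * m))⁻¹ * B) := by
    set z3 := (⟨((3 : ℕ) : ℝ), Nat.cast_pos.mpr (NeZero.pos 3)⟩ : {x : ℝ // 0 < x}) • z with hz3
    have hz : (z3 : ℂ) = 3 * (z : ℂ) := by
      rw [hz3, UpperHalfPlane.coe_pos_real_smul]; simp
    have hsw := tsum_coprime_eq_left (summable_swap hk z3)
    rw [eisenstein_eq_tsum_coprime hk]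
    have h0 : ∑' p : ℤ × ℤ, {p : ℤ × ℤ | IsCoprime p.1 p.2}.indicator
        (fun p => (((p.1 : ℂ) * z3 + p.2) ^ (2 * m))⁻¹) p =
        ∑' p : ℤ × ℤ, {p : ℤ × ℤ | IsCoprime p.1 p.2}.indicator
        (fun p => (((p.2 : ℂ) * z3 + p.1) ^ (2 * m))⁻¹) p := by
      rw [← (Equiv.prodComm ℤ ℤ).tsum_eq]
      refine tsum_congr fun p => ?_
      simp [Set.indicator, isCoprime_comm]
    rw [h0, hsw, hA, hB, ← tsum_mul_left]
    congr 2
    · refine tsum_congr fun p => ?_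
      simp only [hz]
      congr 1
      ext p
      ring_nf
    · refine tsum_congr fun p => ?_
      by_cases hp : p ∈ admissiblePairs
      · simp only [Set.indicator_of_mem hp, hz, ← mul_inv, ← mul_pow]
        push_cast
        ring_nf
      · simp only [Set.indicator_of_notMem hp, mul_zero]
  have h3 : ((3 : ℂ) ^ m) ≠ 0 := pow_ne_zero _ (by norm_num)
  have h31 : ((3 : ℂ) ^ m) + 1 ≠ 0 := by
    have : ((3 : ℂ) ^ m) + 1 = ((3 ^ m + 1 : ℕ) : ℂ) := by push_cast; rfl
    rw [this]; exact_mod_cast Nat.succ_ne_zero (3 ^ m)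
  rw [hF, frickeEisenstein, hE3, hE1, Nat.mul_div_cancel_left m two_pos, mul_comm 2 m, pow_mul]
  push_cast
  field_simp
  ring

/-! ### Norm forms and explicit tail bounds for their lattice sums. -/

/-- The norm form `3 a² - 3 a b + b²`. -/
def pairNorm (p : ℤ × ℤ) : ℤ := 3 * p.1 ^ 2 - 3 * p.1 * p.2 + p.2 ^ 2

/-- The form `3 a² - 3 |a b| + b²`. -/
def absPairNorm (p : ℤ × ℤ) : ℤ := 3 * p.1 ^ 2 - 3 * |p.1 * p.2| + p.2 ^ 2

/-- Modulo 3 the form is `b² = 1`, so only the value 4 has to be excluded. It is taken only when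
both entries are even, against coprimality. -/
lemma pairNorm_eq_one_or_seven_le {p : ℤ × ℤ} (hp : p ∈ admissiblePairs) :
    pairNorm p = 1 ∨ 7 ≤ pairNorm p := by
  obtain ⟨a, b⟩ := p
  obtain ⟨hc, h3⟩ := hp
  simp only [pairNorm] at *
  have hmod : (3 * a ^ 2 - 3 * a * b + b ^ 2) % 3 = 1 := by
    have : b % 3 = 1 ∨ b % 3 = 2 := by omega
    have h1 : (3 * a ^ 2 - 3 * a * b + b ^ 2) % 3 = (b % 3) ^ 2 % 3 := by
      rw [show 3 * a ^ 2 - 3 * a * b + b ^ 2 = b ^ 2 + 3 * (a ^ 2 - a * b) by ring,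
        Int.add_mul_emod_self_left, pow_two, pow_two, Int.mul_emod]
    rw [h1]
    rcases this with h | h <;> rw [h] <;> norm_num
  have hnn : 0 ≤ 3 * a ^ 2 - 3 * a * b + b ^ 2 := by
    nlinarith [sq_nonneg (2 * b - 3 * a), sq_nonneg a]
  have h4 : 3 * a ^ 2 - 3 * a * b + b ^ 2 ≠ 4 := by
    intro h
    have hle : a ^ 2 ≤ 5 := by nlinarith [sq_nonneg (2 * b - 3 * a)]
    have ha1 : a ≤ 2 := by nlinarith
    have ha2 : -2 ≤ a := by nlinarith
    have hle : (2 * b - 3 * a) ^ 2 ≤ 16 := by nlinarith [sq_nonneg a]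
    have hb1 : 2 * b - 3 * a ≤ 4 := by nlinarith
    have hb2 : -4 ≤ 2 * b - 3 * a := by nlinarith
    have hb3 : b ≤ 5 := by omega
    have hb4 : -5 ≤ b := by omega
    clear hle hb1 hb2 hnn hmod h3
    rw [Int.isCoprime_iff_gcd_eq_one] at hc
    interval_cases a <;> interval_cases b <;> first | (exfalso; revert h; norm_num; done) | (revert hc; decide)
  omega

lemma mem_of_pairNorm_eq_one {p : ℤ × ℤ} (h : pairNorm p = 1) :
    p ∈ ({(0, 1), (0, -1), (1, 1), (-1, -1), (1, 2), (-1, -2)} : Finset (ℤ × ℤ)) := by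
  obtain ⟨a, b⟩ := p
  simp only [pairNorm] at h
  have hle : a ^ 2 ≤ 1 := by nlinarith [sq_nonneg (2 * b - 3 * a)]
  have ha1 : a ≤ 1 := by nlinarith
  have ha2 : -1 ≤ a := by nlinarith
  have hle : (2 * b - 3 * a) ^ 2 ≤ 4 := by nlinarith [sq_nonneg a]
  have hb1 : 2 * b - 3 * a ≤ 2 := by nlinarith
  have hb2 : -2 ≤ 2 * b - 3 * a := by nlinarith
  have hb3 : b ≤ 2 := by omega
  have hb4 : -2 ≤ b := by omega
  clear hle hb1 hb2
  interval_cases a <;> interval_cases b <;> first | (exfalso; revert h; norm_num; done) | decide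

lemma absPairNorm_eq_or (p : ℤ × ℤ) :
    absPairNorm p = pairNorm p ∨ absPairNorm p = pairNorm (p.1, -p.2) := by
  rcases abs_choice (p.1 * p.2) with h | h
  · left; rw [absPairNorm, h, pairNorm]; ring
  · right; rw [absPairNorm, h, pairNorm]; ring

lemma neg_right_mem_admissiblePairs {p : ℤ × ℤ} :
    (p.1, -p.2) ∈ admissiblePairs ↔ p ∈ admissiblePairs := by
  exact and_congr (IsCoprime.neg_right_iff p.1 p.2) (not_congr dvd_neg)

lemma absPairNorm_eq_one_or_seven_le {p : ℤ × ℤ} (hp : p ∈ admissiblePairs) :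
    absPairNorm p = 1 ∨ 7 ≤ absPairNorm p := by
  rcases absPairNorm_eq_or p with h | h <;> rw [h]
  · exact pairNorm_eq_one_or_seven_le hp
  · exact pairNorm_eq_one_or_seven_le (neg_right_mem_admissiblePairs.2 hp)

/-- The shifted pairs `(a, b - a)` of admissible pairs of norm at least seven. -/
def shiftedPairs : Set (ℤ × ℤ) :=
  {q | Int.gcd q.1 q.2 = 1 ∧ ¬ (3 : ℤ) ∣ q.1 + q.2 ∧ 7 ≤ q.1 ^ 2 - q.1 * q.2 + q.2 ^ 2}

instance : DecidablePred (· ∈ shiftedPairs) := fun q =>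
  inferInstanceAs (Decidable (Int.gcd q.1 q.2 = 1 ∧ ¬ (3 : ℤ) ∣ q.1 + q.2 ∧
    7 ≤ q.1 ^ 2 - q.1 * q.2 + q.2 ^ 2))

/-- The summand `(a² - a j + j²)⁻ᵐ` on shifted pairs. -/
noncomputable def shiftedTerm (m : ℕ) (q : ℤ × ℤ) : ℝ :=
  if q ∈ shiftedPairs then (((q.1 ^ 2 - q.1 * q.2 + q.2 ^ 2 : ℤ) : ℝ) ^ m)⁻¹ else 0

lemma shiftedTerm_nonneg (m : ℕ) (q : ℤ × ℤ) : 0 ≤ shiftedTerm m q := by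
  unfold shiftedTerm
  split_ifs with h
  · have : (0 : ℝ) ≤ ((q.1 ^ 2 - q.1 * q.2 + q.2 ^ 2 : ℤ) : ℝ) := by
      exact_mod_cast le_trans (by norm_num) h.2.2
    positivity
  · exact le_rfl

lemma sum_shiftedTerm_small (m : ℕ) :
    ∑ q ∈ Finset.Icc (-3 : ℤ) 3 ×ˢ Finset.Icc (-3 : ℤ) 3, shiftedTerm m q ≤ 20 / 7 ^ m := by
  have hcard : ((Finset.Icc (-3 : ℤ) 3 ×ˢ Finset.Icc (-3 : ℤ) 3).filter
    (· ∈ shiftedPairs)).card = 20 := by decide +kernel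
  unfold shiftedTerm
  rw [← Finset.sum_filter]
  calc _ ≤ ∑ q ∈ (Finset.Icc (-3 : ℤ) 3 ×ˢ Finset.Icc (-3 : ℤ) 3).filter (· ∈ shiftedPairs),
        ((7 : ℝ) ^ m)⁻¹ := by
        refine Finset.sum_le_sum fun q hq => ?_
        have h7 : (7 : ℝ) ≤ ((q.1 ^ 2 - q.1 * q.2 + q.2 ^ 2 : ℤ) : ℝ) := by
          exact_mod_cast (Finset.mem_filter.1 hq).2.2.2
        gcongr
    _ = _ := by rw [Finset.sum_const, hcard]; simp [div_eq_mul_inv]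

/-- The sup-norm sphere of radius `n` has `8n` points, and completing the square in the smaller
variable gives `a² - a j + j² ≥ 3n²/4` on it. -/
lemma sum_shiftedTerm_box (m n : ℕ) (hn : n ≠ 0) :
    ∑ q ∈ (Finset.box n : Finset (ℤ × ℤ)), shiftedTerm m q ≤
      8 * n * (4 / (3 * (n : ℝ) ^ 2)) ^ m := by
  have h : ∀ q ∈ (Finset.box n : Finset (ℤ × ℤ)), shiftedTerm m q ≤
      (4 / (3 * (n : ℝ) ^ 2)) ^ m := by
    intro q hq
    unfold shiftedTerm
    split_ifs with hq'
    · rw [Int.mem_box] at hq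
      have h1 : 3 * (n : ℤ) ^ 2 ≤ 4 * (q.1 ^ 2 - q.1 * q.2 + q.2 ^ 2) := by
        rcases max_choice q.1.natAbs q.2.natAbs with h | h <;> rw [h] at hq <;> rw [← hq] <;>
          simp only [Int.natCast_natAbs, sq_abs]
        · nlinarith [sq_nonneg (2 * q.2 - q.1)]
        · nlinarith [sq_nonneg (2 * q.1 - q.2)]
      have h2 : 3 * (n : ℝ) ^ 2 ≤ 4 * ((q.1 ^ 2 - q.1 * q.2 + q.2 ^ 2 : ℤ) : ℝ) := by
        exact_mod_cast h1
      have hn' : (0 : ℝ) < n := by exact_mod_cast Nat.pos_of_ne_zero hn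
      rw [← inv_pow]
      have hpos : 0 < ((q.1 ^ 2 - q.1 * q.2 + q.2 ^ 2 : ℤ) : ℝ) := by nlinarith [sq_pos_of_pos hn']
      refine pow_le_pow_left₀ (inv_nonneg.2 hpos.le) ?_ m
      rw [inv_eq_one_div, div_le_div_iff₀ hpos (by positivity)]
      linarith
    · positivity
  calc _ ≤ _ := Finset.sum_le_sum h
    _ = _ := by rw [Finset.sum_const, Int.card_box hn]; push_cast [nsmul_eq_mul]; ring

/-- Telescoping: `2/n³ ≤ 2/((n-1)n(n+1)) = 1/((n-1)n) - 1/(n(n+1))`. -/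
lemma sum_Ico_inv_cube (N : ℕ) (hN : 4 ≤ N) :
    ∑ n ∈ Finset.Ico 4 N, 8 * (n : ℝ) * (4 / (3 * (n : ℝ) ^ 2)) ^ 2 ≤
      64 / 9 * (1 / 12 - 1 / (((N : ℝ) - 1) * N)) := by
  induction N, hN using Nat.le_induction with
  | base => norm_num
  | succ N hN ih =>
    rw [Finset.sum_Ico_succ_top hN]
    refine (add_le_add_left ih _).trans ?_
    have hN' : (4 : ℝ) ≤ N := by exact_mod_cast hN
    have hN0 : (0 : ℝ) < N := by linarith
    have hN1 : (0 : ℝ) < (N : ℝ) - 1 := by linarith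
    push_cast
    rw [add_sub_cancel_right]
    have : 8 * (N : ℝ) * (4 / (3 * (N : ℝ) ^ 2)) ^ 2 = 64 / 9 * (2 / N ^ 3) := by
      field_simp; norm_num
    rw [this, ← mul_add]
    refine mul_le_mul_of_nonneg_left ?_ (by norm_num)
    have key : 2 / (N : ℝ) ^ 3 ≤ 1 / (((N : ℝ) - 1) * N) - 1 / (N * (N + 1)) := by
      rw [div_sub_div _ _ (by positivity) (by positivity), div_le_div_iff₀ (by positivity)
        (by positivity)]
      nlinarith [pow_pos hN0 2, pow_pos hN0 3]
    linarith

/-- Midpoint rule for the convex function `4x⁻⁵`: its value at `n` is at most its integral over `[n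
- 1/2, n + 1/2]`, and these integrals telescope. The constant `16/2401` is `(7/2)⁻⁴`. -/
lemma sum_Ico_inv_fifth (N : ℕ) (hN : 4 ≤ N) :
    ∑ n ∈ Finset.Ico 4 N, 8 * (n : ℝ) * (4 / (3 * (n : ℝ) ^ 2)) ^ 3 ≤
      128 / 27 * (16 / 2401 - 1 / ((N : ℝ) - 1 / 2) ^ 4) := by
  induction N, hN using Nat.le_induction with
  | base => norm_num
  | succ N hN ih =>
    rw [Finset.sum_Ico_succ_top hN]
    refine (add_le_add_left ih _).trans ?_
    have hN' : (4 : ℝ) ≤ N := by exact_mod_cast hN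
    have hN0 : (0 : ℝ) < N := by linarith
    have hN1 : (0 : ℝ) < (N : ℝ) - 1 / 2 := by linarith
    push_cast
    have : 8 * (N : ℝ) * (4 / (3 * (N : ℝ) ^ 2)) ^ 3 = 128 / 27 * (4 / N ^ 5) := by
      field_simp; norm_num
    rw [this, ← mul_add, show (N : ℝ) + 1 - 1 / 2 = N + 1 / 2 by ring]
    refine mul_le_mul_of_nonneg_left ?_ (by norm_num)
    have key : 4 / (N : ℝ) ^ 5 ≤ 1 / ((N : ℝ) - 1 / 2) ^ 4 - 1 / ((N : ℝ) + 1 / 2) ^ 4 := by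
      rw [div_sub_div _ _ (by positivity) (by positivity), div_le_div_iff₀ (by positivity)
        (by positivity), ← mul_pow]
      have e1 : 1 * ((N : ℝ) + 1 / 2) ^ 4 - ((N : ℝ) - 1 / 2) ^ 4 * 1 = N * (4 * N ^ 2 + 1) := by ring
      have e2 : ((N : ℝ) - 1 / 2) * (N + 1 / 2) = N ^ 2 - 1 / 4 := by ring
      rw [e1, e2]
      have h1 : ((N : ℝ) ^ 2 - 1 / 4) ^ 4 ≤ (N ^ 2) ^ 4 := by
        refine pow_le_pow_left₀ (by nlinarith) (by linarith) 4
      nlinarith [pow_pos hN0 6, pow_pos hN0 8]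
    linarith

lemma sum_shiftedTerm_le {m : ℕ} {c : ℝ}
    (hc : ∀ N : ℕ, 4 ≤ N → ∑ n ∈ Finset.Ico 4 N, 8 * (n : ℝ) * (4 / (3 * (n : ℝ) ^ 2)) ^ m ≤ c)
    (u : Finset (ℤ × ℤ)) : ∑ q ∈ u, shiftedTerm m q ≤ 20 / 7 ^ m + c := by
  obtain ⟨N, hN4, hN⟩ : ∃ N : ℕ, 4 ≤ N ∧ ∀ q ∈ u, max q.1.natAbs q.2.natAbs < N := by
    refine ⟨u.sup (fun q => max q.1.natAbs q.2.natAbs) + 4, by omega, fun q hq => ?_⟩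
    have := Finset.le_sup (f := fun q : ℤ × ℤ => max q.1.natAbs q.2.natAbs) hq
    omega
  set B := Finset.Icc (-3 : ℤ) 3 ×ˢ Finset.Icc (-3 : ℤ) 3
  set T := (Finset.Ico 4 N).biUnion (fun n => (Finset.box n : Finset (ℤ × ℤ)))
  have hsub : u ⊆ B ∪ T := by
    intro q hq
    have hlt := hN q hq
    simp only [B, T, Finset.mem_union, Finset.mem_product, Finset.mem_Icc, Finset.mem_biUnion,
      Finset.mem_Ico, Int.mem_box]
    by_cases h : max q.1.natAbs q.2.natAbs < 4
    · left; omega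
    · right; exact ⟨_, ⟨by omega, hlt⟩, rfl⟩
  calc _ ≤ ∑ q ∈ B ∪ T, shiftedTerm m q :=
        Finset.sum_le_sum_of_subset_of_nonneg hsub fun q _ _ => shiftedTerm_nonneg m q
    _ ≤ ∑ q ∈ B, shiftedTerm m q + ∑ q ∈ T, shiftedTerm m q := by
        rw [← Finset.sum_union_inter]
        exact le_add_of_nonneg_right (Finset.sum_nonneg fun q _ => shiftedTerm_nonneg m q)
    _ ≤ _ := by
        refine add_le_add (sum_shiftedTerm_small m) ?_
        refine le_trans ?_ (hc N hN4)
        rw [Finset.sum_biUnion]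
        · exact Finset.sum_le_sum fun n hn => sum_shiftedTerm_box m n
            (by have := (Finset.mem_Ico.1 hn).1; omega)
        · intro i _ j _ hij
          refine Finset.disjoint_left.2 fun q h1 h2 => hij ?_
          rw [Int.mem_box] at h1 h2
          omega

/-- The summand `N(p)⁻ᵐ` over admissible pairs of norm `N(p) ≥ 7`. -/
noncomputable def normTail (m : ℕ) (p : ℤ × ℤ) : ℝ :=
  {p | p ∈ admissiblePairs ∧ 7 ≤ pairNorm p}.indicator (fun p => ((pairNorm p : ℝ) ^ m)⁻¹) p

/-- The analogue of `normTail` for `absPairNorm`. -/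
noncomputable def absNormTail (m : ℕ) (p : ℤ × ℤ) : ℝ :=
  {p | p ∈ admissiblePairs ∧ 7 ≤ absPairNorm p}.indicator
    (fun p => ((absPairNorm p : ℝ) ^ m)⁻¹) p

/-- Shifting `b` by `a` turns the form into the Eisenstein form, whose minimum on sup-norm spheres
is easy to bound. -/
lemma normTail_eq_shiftedTerm (m : ℕ) (p : ℤ × ℤ) :
    normTail m p = shiftedTerm m (p.1, p.2 - p.1) := by
  have h1 : pairNorm p = p.1 ^ 2 - p.1 * (p.2 - p.1) + (p.2 - p.1) ^ 2 := by
    rw [pairNorm]; ring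
  have h2 : (p ∈ admissiblePairs ∧ 7 ≤ pairNorm p) ↔ (p.1, p.2 - p.1) ∈ shiftedPairs := by
    simp only [admissiblePairs, shiftedPairs, Set.mem_ofPred_eq, ← h1, and_assoc,
      Int.isCoprime_iff_gcd_eq_one, add_sub_cancel]
    rw [Int.gcd_sub_self_right]
  unfold normTail shiftedTerm
  by_cases h : p ∈ admissiblePairs ∧ 7 ≤ pairNorm p
  · rw [Set.indicator_of_mem (by exact h), if_pos (h2.1 h), h1]
  · rw [Set.indicator_of_notMem (by exact h), if_neg (mt h2.2 h)]

lemma normTail_nonneg (m : ℕ) (p : ℤ × ℤ) : 0 ≤ normTail m p := by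
  rw [normTail_eq_shiftedTerm]; exact shiftedTerm_nonneg _ _

lemma summable_normTail_and_le {m : ℕ} {c : ℝ}
    (hc : ∀ N : ℕ, 4 ≤ N → ∑ n ∈ Finset.Ico 4 N, 8 * (n : ℝ) * (4 / (3 * (n : ℝ) ^ 2)) ^ m ≤ c) :
    Summable (normTail m) ∧ ∑' p, normTail m p ≤ 20 / 7 ^ m + c := by
  have hS : ∀ u : Finset (ℤ × ℤ), ∑ p ∈ u, normTail m p ≤ 20 / 7 ^ m + c := by
    intro u
    have hinj : Function.Injective (fun p : ℤ × ℤ => (p.1, p.2 - p.1)) := by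
      rintro ⟨a, b⟩ ⟨c, d⟩ h
      simp only [Prod.mk.injEq] at h ⊢
      omega
    have := sum_shiftedTerm_le hc (u.map ⟨_, hinj⟩)
    rw [Finset.sum_map] at this
    simp only [normTail_eq_shiftedTerm]
    exact this
  exact ⟨summable_of_sum_le (normTail_nonneg m) hS, Real.tsum_le_of_sum_le (normTail_nonneg m) hS⟩

lemma normTail_two : Summable (normTail 2) ∧ ∑' p, normTail 2 p ≤ 6 / 5 := by
  refine (summable_normTail_and_le (c := 64 / 9 * (1 / 12)) fun N hN => ?_).imp_right
    fun h => h.trans (by norm_num)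
  have hN' : (4 : ℝ) ≤ N := by exact_mod_cast hN
  have : 0 ≤ 1 / (((N : ℝ) - 1) * N) := by
    have : 0 < (N : ℝ) - 1 := by linarith
    positivity
  linarith [sum_Ico_inv_cube N hN]

lemma normTail_three : Summable (normTail 3) ∧ ∑' p, normTail 3 p ≤ 9 / 100 := by
  refine (summable_normTail_and_le (c := 128 / 27 * (16 / 2401)) fun N hN => ?_).imp_right
    fun h => h.trans (by norm_num)
  have hN' : (4 : ℝ) ≤ N := by exact_mod_cast hN
  have : 0 ≤ 1 / ((N : ℝ) - 1 / 2) ^ 4 := by positivity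
  linarith [sum_Ico_inv_fifth N hN]

lemma normTail_le {m : ℕ} (hm : 3 ≤ m) (p : ℤ × ℤ) :
    normTail m p ≤ (7 ^ (m - 3))⁻¹ * normTail 3 p := by
  unfold normTail
  by_cases h : p ∈ admissiblePairs ∧ 7 ≤ pairNorm p
  · rw [Set.indicator_of_mem (by exact h), Set.indicator_of_mem (by exact h), ← mul_inv]
    have h7 : (7 : ℝ) ≤ pairNorm p := by exact_mod_cast h.2
    have : (pairNorm p : ℝ) ^ m = (pairNorm p : ℝ) ^ (m - 3) * (pairNorm p : ℝ) ^ 3 := by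
      rw [← pow_add]; congr 1; omega
    rw [this]
    gcongr
  · rw [Set.indicator_of_notMem (by exact h), Set.indicator_of_notMem (by exact h), mul_zero]

lemma normTail_of_three_le {m : ℕ} (hm : 3 ≤ m) :
    Summable (normTail m) ∧ ∑' p, normTail m p ≤ (7 ^ (m - 3))⁻¹ * (9 / 100) := by
  have h3 := normTail_three
  have hS : Summable (normTail m) :=
    Summable.of_nonneg_of_le (normTail_nonneg m) (normTail_le hm) (h3.1.mul_left _)
  refine ⟨hS, (hS.tsum_le_tsum (normTail_le hm) (h3.1.mul_left _)).trans ?_⟩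
  rw [tsum_mul_left]
  exact mul_le_mul_of_nonneg_left h3.2 (by positivity)

lemma absNormTail_nonneg (m : ℕ) (p : ℤ × ℤ) : 0 ≤ absNormTail m p := by
  unfold absNormTail
  refine Set.indicator_apply_nonneg fun h => ?_
  have : (0 : ℝ) ≤ absPairNorm p := by exact_mod_cast le_trans (by norm_num) h.2
  positivity

lemma absNormTail_le (m : ℕ) (p : ℤ × ℤ) :
    absNormTail m p ≤ normTail m p + normTail m (p.1, -p.2) := by
  by_cases h : p ∈ admissiblePairs ∧ 7 ≤ absPairNorm p
  · rw [absNormTail, Set.indicator_of_mem (by exact h)]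
    rcases absPairNorm_eq_or p with h' | h' <;> rw [h']
    · rw [normTail, Set.indicator_of_mem (by exact ⟨h.1, h' ▸ h.2⟩)]
      exact le_add_of_nonneg_right (normTail_nonneg _ _)
    · rw [normTail.eq_1 m (p.1, -p.2),
        Set.indicator_of_mem (by exact ⟨neg_right_mem_admissiblePairs.2 h.1, h' ▸ h.2⟩)]
      exact le_add_of_nonneg_left (normTail_nonneg _ _)
  · rw [absNormTail, Set.indicator_of_notMem (by exact h)]
    exact add_nonneg (normTail_nonneg _ _) (normTail_nonneg _ _)

lemma absNormTail_of_three_le {m : ℕ} (hm : 3 ≤ m) :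
    Summable (absNormTail m) ∧ ∑' p, absNormTail m p ≤ (7 ^ (m - 3))⁻¹ * (9 / 50) := by
  obtain ⟨h1, h2⟩ := normTail_of_three_le hm
  set e : ℤ × ℤ ≃ ℤ × ℤ := Equiv.prodCongr (Equiv.refl ℤ) (Equiv.neg ℤ)
  have he : ∀ p, normTail m (p.1, -p.2) = normTail m (e p) := fun p => rfl
  have h1' : Summable fun p : ℤ × ℤ => normTail m (p.1, -p.2) := e.summable_iff.2 h1
  have hS : Summable (absNormTail m) := Summable.of_nonneg_of_le (absNormTail_nonneg m)
    (absNormTail_le m) (h1.add h1')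
  refine ⟨hS, (hS.tsum_le_tsum (absNormTail_le m) (h1.add h1')).trans ?_⟩
  rw [h1.tsum_add h1']
  have : ∑' p : ℤ × ℤ, normTail m (p.1, -p.2) = ∑' p, normTail m p := e.tsum_eq (normTail m)
  linarith

lemma tsum_indicator_split {f : ℤ × ℤ → ℂ} {U : Finset (ℤ × ℤ)} {S T : Set (ℤ × ℤ)}
    (hUS : ∀ p ∈ U, p ∈ S) (hST : ∀ p, p ∈ T ↔ p ∈ S ∧ p ∉ U) (hf : Summable (S.indicator f)) :
    ∑' p, S.indicator f p = ∑ p ∈ U, f p + ∑' p, T.indicator f p := by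
  have hT : T.indicator f = (T.indicator (S.indicator f)) := by
    rw [Set.indicator_indicator, Set.inter_eq_left.2 fun p hp => ((hST p).1 hp).1]
  have hsplit : ∀ p, S.indicator f p = (U : Set (ℤ × ℤ)).indicator (S.indicator f) p +
      T.indicator f p := by
    intro p
    by_cases hS : p ∈ S <;> by_cases hU : p ∈ U
    · simp [hS, hU, (hST p).not.2 (by tauto)]
    · simp [hS, hU, (hST p).2 ⟨hS, hU⟩]
    · exact absurd (hUS p hU) hS
    · simp [hS, hU, (hST p).not.2 (by tauto)]
  rw [tsum_congr hsplit, (hf.indicator _).tsum_add (by rw [hT]; exact hf.indicator _)]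
  congr 1
  rw [tsum_eq_sum (s := U) (fun p hp => Set.indicator_of_notMem (by simpa using hp) _)]
  refine Finset.sum_congr rfl fun p hp => ?_
  rw [Set.indicator_of_mem (by simpa using hp), Set.indicator_of_mem (hUS p hp)]

/-! ### Twelvefold rotational symmetry at the corner. -/

/-- The corner `e^{5πi/6}` of the fundamental domain in the variable `s = √3 z`. -/
noncomputable def cornerPoint : ℂ := ⟨-√3 / 2, 1 / 2⟩

lemma sqrt_three_sq : √3 ^ 2 = 3 := Real.sq_sqrt (by norm_num)

lemma cornerPoint_sq : cornerPoint ^ 2 = -((√3 : ℝ) : ℂ) * cornerPoint - 1 := by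
  have h := sqrt_three_sq
  apply Complex.ext <;> simp [cornerPoint, pow_two] <;> nlinarith

lemma conj_mul_cornerPoint : conj cornerPoint * cornerPoint = 1 := by
  have h := sqrt_three_sq
  apply Complex.ext <;> simp [cornerPoint] <;> nlinarith

lemma sqrt_three_sq_complex : ((√3 : ℝ) : ℂ) ^ 2 = 3 := by
  rw [← Complex.ofReal_pow, sqrt_three_sq]; norm_num

lemma cornerPoint_pow_four : cornerPoint ^ 4 = cornerPoint ^ 2 - 1 := by
  linear_combination (cornerPoint ^ 2 - ((√3 : ℝ) : ℂ) * cornerPoint + 1) * cornerPoint_sq +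
    cornerPoint ^ 2 * sqrt_three_sq_complex

lemma cornerPoint_pow_six : cornerPoint ^ 6 = -1 := by
  linear_combination (cornerPoint ^ 2 + 1) * cornerPoint_pow_four

lemma cornerPoint_pow_twelve : cornerPoint ^ 12 = 1 := by
  rw [show 12 = 6 * 2 by norm_num, pow_mul, cornerPoint_pow_six]; norm_num

lemma cornerPoint_ne_zero : cornerPoint ≠ 0 := by
  intro h; have := cornerPoint_pow_twelve; rw [h] at this; norm_num at this

lemma orderOf_cornerPoint_inv_sq : orderOf (cornerPoint⁻¹ ^ 2) = 6 := by
  have h6 : (cornerPoint⁻¹ ^ 2) ^ 6 = 1 := by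
    rw [← pow_mul, inv_pow, cornerPoint_pow_twelve, inv_one]
  refine orderOf_eq_of_pow_and_pow_div_prime (by norm_num) h6 ?_
  intro p hp hp6
  have hp' : p = 2 ∨ p = 3 := by
    have : p ≤ 6 := Nat.le_of_dvd (by norm_num) hp6
    interval_cases p <;> revert hp hp6 <;> norm_num
  rcases hp' with rfl | rfl
  · rw [show 6 / 2 = 3 by norm_num, ← pow_mul, inv_pow, cornerPoint_pow_six]; norm_num
  · rw [show 6 / 3 = 2 by norm_num, ← pow_mul, inv_pow]
    intro h
    rw [inv_eq_one, cornerPoint_pow_four] at h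
    have h2 : cornerPoint ^ 2 = 2 := by linear_combination h
    have h4 := cornerPoint_pow_four
    rw [show cornerPoint ^ 4 = (cornerPoint ^ 2) ^ 2 by ring, h2] at h4
    norm_num at h4

lemma sum_range_pow_cornerPoint (n : ℕ) :
    ∑ j ∈ Finset.range 12, ((cornerPoint⁻¹ ^ 2) ^ n) ^ j = if 6 ∣ n then 12 else 0 := by
  split_ifs with h
  · rw [← orderOf_cornerPoint_inv_sq, orderOf_dvd_iff_pow_eq_one] at h
    rw [h]; simp
  · rw [← orderOf_cornerPoint_inv_sq, orderOf_dvd_iff_pow_eq_one] at h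
    have h12 : ((cornerPoint⁻¹ ^ 2) ^ n) ^ 12 = 1 := by
      rw [← pow_mul, ← pow_mul, show 2 * (n * 12) = 12 * (2 * n) by ring, pow_mul, inv_pow,
        cornerPoint_pow_twelve, inv_one, one_pow]
    rw [geom_sum_eq h, h12, sub_self, zero_div]

/-- By `ρ² = -√3 ρ - 1`, multiplication by `ρ` exchanges the two families of forms at the corner.
This and the next lemma give the invariance under twelfth roots of unity. -/
lemma cornerPoint_mul_linForm (p : ℤ × ℤ) :
    cornerPoint * linForm cornerPoint p = dualForm cornerPoint (-p.1, p.2 - 3 * p.1) := by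
  simp only [linForm, dualForm]
  push_cast
  linear_combination (((√3 : ℝ) : ℂ) * p.1) * cornerPoint_sq -
    p.1 * cornerPoint * sqrt_three_sq_complex

lemma cornerPoint_mul_dualForm (p : ℤ × ℤ) :
    cornerPoint * dualForm cornerPoint p = linForm cornerPoint (p.1 - p.2, -p.2) := by
  simp only [linForm, dualForm]
  push_cast
  linear_combination (p.2 : ℂ) * cornerPoint_sq

lemma norm_linForm_cornerPoint_sq (p : ℤ × ℤ) : ‖linForm cornerPoint p‖ ^ 2 = pairNorm p := by
  rw [← Complex.normSq_eq_norm_sq, Complex.normSq_apply]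
  have h := sqrt_three_sq
  simp [linForm, cornerPoint, pairNorm]
  linear_combination ((p.1 : ℝ) ^ 2 * (√3 ^ 2 + 4) / 4 - p.1 * p.2) * h

/-- The involution `(a, b) ↦ (-a, b - 3a)`. -/
def linToDual : ℤ × ℤ ≃ ℤ × ℤ :=
  Function.Involutive.toPerm (fun p => (-p.1, p.2 - 3 * p.1)) fun p => by ext <;> simp

/-- The involution `(a, b) ↦ (a - b, -b)`. -/
def dualToLin : ℤ × ℤ ≃ ℤ × ℤ :=
  Function.Involutive.toPerm (fun p => (p.1 - p.2, -p.2)) fun p => by ext <;> simp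

lemma linToDual_mem (p : ℤ × ℤ) : linToDual p ∈ admissiblePairs ↔ p ∈ admissiblePairs := by
  refine and_congr ?_ (not_congr ?_)
  · change IsCoprime (-p.1) (p.2 - 3 * p.1) ↔ _
    rw [IsCoprime.neg_left_iff, sub_eq_add_neg, ← neg_mul, IsCoprime.add_mul_right_right_iff]
  · change 3 ∣ p.2 - 3 * p.1 ↔ _
    omega

lemma dualToLin_mem (p : ℤ × ℤ) : dualToLin p ∈ admissiblePairs ↔ p ∈ admissiblePairs := by
  refine and_congr ?_ (not_congr ?_)
  · change IsCoprime (p.1 - p.2) (-p.2) ↔ _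
    rw [IsCoprime.neg_right_iff, sub_eq_add_neg, ← neg_one_mul, IsCoprime.add_mul_right_left_iff]
  · change 3 ∣ -p.2 ↔ _
    omega

lemma tsum_cornerPoint_mul_linForm (g : ℂ → ℂ) :
    ∑' p, admissiblePairs.indicator (fun p => g (cornerPoint * linForm cornerPoint p)) p =
      ∑' p, admissiblePairs.indicator (fun p => g (dualForm cornerPoint p)) p := by
  rw [← linToDual.tsum_eq (admissiblePairs.indicator (fun p => g (dualForm cornerPoint p)))]
  refine tsum_congr fun p => ?_
  exact indicator_apply_congr (linToDual_mem p).symm (by rw [cornerPoint_mul_linForm]; rfl)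

lemma tsum_cornerPoint_mul_dualForm (g : ℂ → ℂ) :
    ∑' p, admissiblePairs.indicator (fun p => g (cornerPoint * dualForm cornerPoint p)) p =
      ∑' p, admissiblePairs.indicator (fun p => g (linForm cornerPoint p)) p := by
  rw [← dualToLin.tsum_eq (admissiblePairs.indicator (fun p => g (linForm cornerPoint p)))]
  refine tsum_congr fun p => ?_
  exact indicator_apply_congr (dualToLin_mem p).symm (by rw [cornerPoint_mul_dualForm]; rfl)

lemma tsum_cornerPoint_pow_even (g : ℂ → ℂ) (j : ℕ) :
    ∑' p, admissiblePairs.indicator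
      (fun p => g (cornerPoint ^ (2 * j) * linForm cornerPoint p)) p =
      ∑' p, admissiblePairs.indicator (fun p => g (linForm cornerPoint p)) p := by
  induction j with
  | zero => simp
  | succ j ih =>
    rw [← ih]
    have h1 := tsum_cornerPoint_mul_linForm (fun v => g (cornerPoint ^ (2 * j) * (cornerPoint * v)))
    have h2 := tsum_cornerPoint_mul_dualForm (fun v => g (cornerPoint ^ (2 * j) * v))
    rw [← h2, ← h1]
    refine tsum_congr fun p => indicator_apply_congr Iff.rfl ?_
    congr 1; ring

lemma tsum_cornerPoint_pow_odd (g : ℂ → ℂ) (j : ℕ) :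
    ∑' p, admissiblePairs.indicator
      (fun p => g (cornerPoint ^ (2 * j + 1) * linForm cornerPoint p)) p =
      ∑' p, admissiblePairs.indicator (fun p => g (dualForm cornerPoint p)) p := by
  rw [← tsum_cornerPoint_mul_linForm g,
    ← tsum_cornerPoint_pow_even (fun v => g (cornerPoint * v)) j]
  refine tsum_congr fun p => indicator_apply_congr Iff.rfl ?_
  congr 1; ring

/-- The six admissible pairs of norm one. -/
def unitPairs : Finset (ℤ × ℤ) := {(0, 1), (0, -1), (1, 1), (-1, -1), (1, 2), (-1, -2)}

lemma unitPairs_subset : ∀ p ∈ unitPairs, p ∈ admissiblePairs := by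
  intro p hp
  simp only [unitPairs, Finset.mem_insert, Finset.mem_singleton] at hp
  rcases hp with rfl | rfl | rfl | rfl | rfl | rfl <;>
    exact ⟨by rw [Int.isCoprime_iff_gcd_eq_one]; decide, by decide⟩

lemma mem_normTail_iff (p : ℤ × ℤ) :
    p ∈ {p : ℤ × ℤ | p ∈ admissiblePairs ∧ 7 ≤ pairNorm p} ↔ p ∈ admissiblePairs ∧ p ∉ unitPairs := by
  refine and_congr_right fun hp => ⟨fun h hU => ?_, fun h => ?_⟩
  · simp only [unitPairs, Finset.mem_insert, Finset.mem_singleton] at hU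
    rcases hU with rfl | rfl | rfl | rfl | rfl | rfl <;> revert h <;> decide
  · exact (pairNorm_eq_one_or_seven_le hp).resolve_left fun h1 => h (mem_of_pairNorm_eq_one h1)

/-- The tail controls norms at least 7, and only six admissible pairs remain. -/
lemma summable_of_norm_le_pairNorm {m : ℕ} (hS : Summable (normTail m)) {f : ℤ × ℤ → ℂ} {C : ℝ}
    (hf : ∀ p ∈ admissiblePairs, ‖f p‖ ≤ C * ((pairNorm p : ℝ) ^ m)⁻¹) :
    Summable (admissiblePairs.indicator f) := by
  have h1 : Summable ((unitPairs : Set (ℤ × ℤ)).indicator (admissiblePairs.indicator f)) :=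
    summable_of_ne_finset_zero (s := unitPairs) fun p hp =>
      Set.indicator_of_notMem (by simpa using hp) _
  have h2 : Summable ({p : ℤ × ℤ | p ∈ admissiblePairs ∧ 7 ≤ pairNorm p}.indicator f) := by
    refine Summable.of_norm_bounded (hS.mul_left C) fun p => ?_
    rw [normTail]
    by_cases hp : p ∈ {p : ℤ × ℤ | p ∈ admissiblePairs ∧ 7 ≤ pairNorm p}
    · rw [Set.indicator_of_mem hp, Set.indicator_of_mem hp]
      exact hf p hp.1
    · rw [Set.indicator_of_notMem hp, Set.indicator_of_notMem hp]; simp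
  refine (h1.add h2).congr fun p => ?_
  have hT := mem_normTail_iff p
  by_cases hS : p ∈ admissiblePairs <;> by_cases hU : p ∈ unitPairs
  · rw [Set.indicator_of_notMem (s := {p | _}) (hT.not.2 (by tauto)),
      Set.indicator_of_mem (by simpa using hU), add_zero]
  · rw [Set.indicator_of_mem (s := {p | _}) (hT.2 ⟨hS, hU⟩),
      Set.indicator_of_notMem (by simpa using hU), zero_add, Set.indicator_of_mem hS]
  · exact absurd (unitPairs_subset p hU) hS
  · rw [Set.indicator_of_notMem (s := {p | _}) (hT.not.2 (by tauto)),
      Set.indicator_of_notMem (by simpa using hU), zero_add, Set.indicator_of_notMem hS]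

/-! ### Power series in the disc coordinate. -/

/-- The summand `(v - v̄ w)⁻ᵏ` in the disc coordinate `w` centred at the corner. -/
noncomputable def discTerm (k : ℕ) (w v : ℂ) : ℂ := ((v - conj v * w) ^ k)⁻¹

/-- The sum of `discTerm` over the orbit of `v` under the twelfth roots of unity. -/
noncomputable def orbitTerm (k : ℕ) (w v : ℂ) : ℂ :=
  ∑ j ∈ Finset.range 12, discTerm k w (cornerPoint ^ j * v)

/-- The Taylor coefficients of `orbitTerm (2 * m) · 1`, divided by twelve. -/
noncomputable def orbitCoeff (m i : ℕ) : ℝ :=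
  if 6 ∣ m + i then ((i + (2 * m - 1)).choose (2 * m - 1) : ℝ) else 0

lemma orbitCoeff_nonneg (m i : ℕ) : 0 ≤ orbitCoeff m i := by
  unfold orbitCoeff; split_ifs <;> positivity

lemma norm_conj_div_self {v : ℂ} (hv : v ≠ 0) : ‖conj v / v‖ = 1 := by
  rw [norm_div, Complex.norm_conj, div_self (norm_ne_zero_iff.2 hv)]

lemma hasSum_discTerm {m : ℕ} (hm : 1 ≤ m) {w v : ℂ} (hw : ‖w‖ < 1) (hv : v ≠ 0) :
    HasSum (fun i : ℕ => (((i + (2 * m - 1)).choose (2 * m - 1) : ℝ) : ℂ) *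
      ((v ^ (2 * m))⁻¹ * (conj v / v) ^ i * w ^ i)) (discTerm (2 * m) w v) := by
  have hr : ‖conj v / v * w‖ < 1 := by rwa [norm_mul, norm_conj_div_self hv, one_mul]
  have h := (hasSum_choose_mul_geometric_of_norm_lt_one (2 * m - 1) hr).mul_left (v ^ (2 * m))⁻¹
  rw [show 2 * m - 1 + 1 = 2 * m by omega] at h
  rw [discTerm, show v - conj v * w = v * (1 - conj v / v * w) by field_simp, mul_pow, mul_inv,
    ← one_div ((1 - conj v / v * w) ^ (2 * m))]
  refine HasSum.congr_fun h fun i => ?_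
  rw [mul_pow]; push_cast; ring

/-- Replacing `v` by `ρʲ v` multiplies the `i`-th Taylor coefficient by `ρ^(-2j(m+i))`. Since `ρ⁻²`
has order 6, summing over twelve values of `j` gives 12 or 0. -/
lemma hasSum_orbitTerm {m : ℕ} (hm : 1 ≤ m) {w v : ℂ} (hw : ‖w‖ < 1) (hv : v ≠ 0) :
    HasSum (fun i : ℕ => 12 * (orbitCoeff m i : ℂ) *
      ((v ^ (2 * m))⁻¹ * (conj v / v) ^ i * w ^ i)) (orbitTerm (2 * m) w v) := by
  have h := hasSum_sum (s := Finset.range 12) fun j _ => hasSum_discTerm hm hw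
    (mul_ne_zero (pow_ne_zero j cornerPoint_ne_zero) hv)
  refine HasSum.congr_fun h fun i => ?_
  have hterm : ∀ j : ℕ, ((cornerPoint ^ j * v) ^ (2 * m))⁻¹ *
      (conj (cornerPoint ^ j * v) / (cornerPoint ^ j * v)) ^ i =
      ((cornerPoint⁻¹ ^ 2) ^ (m + i)) ^ j * ((v ^ (2 * m))⁻¹ * (conj v / v) ^ i) := by
    intro j
    have hc : conj cornerPoint = cornerPoint⁻¹ := eq_inv_of_mul_eq_one_left conj_mul_cornerPoint
    rw [map_mul, map_pow, hc, mul_div_mul_comm, mul_pow, mul_pow, mul_inv]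
    have : (cornerPoint⁻¹ ^ j / cornerPoint ^ j) = (cornerPoint⁻¹ ^ 2) ^ j := by
      rw [div_eq_mul_inv, ← inv_pow, ← pow_add, ← pow_mul]; congr 1; ring
    rw [this, ← inv_pow, ← inv_pow]
    ring
  simp_rw [hterm, ← mul_assoc]
  rw [← Finset.sum_mul, ← Finset.sum_mul, ← Finset.sum_mul, ← Finset.mul_sum,
    sum_range_pow_cornerPoint]
  unfold orbitCoeff
  split_ifs <;> push_cast <;> ring

lemma summable_orbitCoeff {m : ℕ} {x : ℝ} (h0 : 0 ≤ x) (hx : x < 1) :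
    Summable fun i => orbitCoeff m i * x ^ i := by
  have hr : ‖x‖ < 1 := by rwa [Real.norm_of_nonneg h0]
  refine Summable.of_nonneg_of_le (fun i => mul_nonneg (orbitCoeff_nonneg m i) (pow_nonneg h0 i))
    (fun i => ?_) (summable_choose_mul_geometric_of_norm_lt_one (2 * m - 1) hr)
  refine mul_le_mul_of_nonneg_right ?_ (pow_nonneg h0 i)
  unfold orbitCoeff
  split_ifs
  · exact le_rfl
  · positivity

lemma norm_orbitTerm_le {m : ℕ} (hm : 1 ≤ m) {w v : ℂ} (hw : ‖w‖ < 1) (hv : v ≠ 0) :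
    ‖orbitTerm (2 * m) w v‖ ≤ 12 * (∑' i, orbitCoeff m i * ‖w‖ ^ i) * (‖v‖ ^ (2 * m))⁻¹ := by
  rw [← (hasSum_orbitTerm hm hw hv).tsum_eq]
  have hs := ((summable_orbitCoeff (m := m) (norm_nonneg w) hw).hasSum.mul_left 12).mul_right
    (‖v‖ ^ (2 * m))⁻¹
  refine tsum_of_norm_bounded hs fun i => le_of_eq ?_
  rw [norm_mul, norm_mul, norm_mul, norm_mul, norm_pow, norm_conj_div_self hv, norm_inv, norm_pow,
    norm_pow, Complex.norm_real, Real.norm_of_nonneg (orbitCoeff_nonneg m i)]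
  norm_num
  ring

/-- The `n`-th term of the series minus the absolute values of all the others. -/
lemma le_norm_orbitTerm_one {m : ℕ} (hm : 1 ≤ m) {w : ℂ} (hw : ‖w‖ < 1) (n : ℕ) :
    12 * (2 * (orbitCoeff m n * ‖w‖ ^ n) - ∑' i, orbitCoeff m i * ‖w‖ ^ i) ≤
      ‖orbitTerm (2 * m) w 1‖ := by
  have h1 := hasSum_ite_sub_hasSum (hasSum_orbitTerm hm hw one_ne_zero) n
  have h2 := (hasSum_ite_sub_hasSum
    (summable_orbitCoeff (m := m) (norm_nonneg w) hw).hasSum n).mul_left 12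
  have h3 := tsum_of_norm_bounded h2 (f := fun i => if i = n then 0 else
    12 * (orbitCoeff m i : ℂ) * (((1 : ℂ) ^ (2 * m))⁻¹ * (conj (1 : ℂ) / 1) ^ i * w ^ i)) (by
    intro i
    split_ifs with h
    · simp
    · simp [abs_of_nonneg (orbitCoeff_nonneg m i), mul_assoc])
  rw [h1.tsum_eq] at h3
  have h4 : ‖12 * (orbitCoeff m n : ℂ) * (((1 : ℂ) ^ (2 * m))⁻¹ * (conj (1 : ℂ) / 1) ^ n * w ^ n)‖ =
      12 * (orbitCoeff m n * ‖w‖ ^ n) := by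
    simp [abs_of_nonneg (orbitCoeff_nonneg m n), mul_assoc]
  have h5 := norm_sub_norm_le (12 * (orbitCoeff m n : ℂ) *
    (((1 : ℂ) ^ (2 * m))⁻¹ * (conj (1 : ℂ) / 1) ^ n * w ^ n)) (orbitTerm (2 * m) w 1)
  rw [norm_sub_rev] at h5
  linarith

lemma orbitTerm_cornerPoint_mul (k : ℕ) (w v : ℂ) :
    orbitTerm k w (cornerPoint * v) = orbitTerm k w v := by
  unfold orbitTerm
  simp_rw [← mul_assoc, ← pow_succ]
  have h1 := Finset.sum_range_succ (fun j => discTerm k w (cornerPoint ^ j * v)) 12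
  rw [Finset.sum_range_succ', cornerPoint_pow_twelve, pow_zero] at h1
  exact add_right_cancel h1

lemma orbitTerm_cornerPoint_pow (k : ℕ) (w : ℂ) (j : ℕ) :
    orbitTerm k w (cornerPoint ^ j) = orbitTerm k w 1 := by
  induction j with
  | zero => rw [pow_zero]
  | succ j ih => rw [pow_succ', orbitTerm_cornerPoint_mul, ih]

/-- At the corner the six unit pairs give the even powers of `ρ`, all in the orbit of 1. -/
lemma orbitTerm_of_mem_unitPairs (k : ℕ) (w : ℂ) {p : ℤ × ℤ} (hp : p ∈ unitPairs) :
    orbitTerm k w (linForm cornerPoint p) = orbitTerm k w 1 := by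
  have h2 := cornerPoint_sq
  have h4 := cornerPoint_pow_four
  have h6 := cornerPoint_pow_six
  have h8 : cornerPoint ^ 8 = -cornerPoint ^ 2 := by linear_combination cornerPoint ^ 2 * h6
  have h10 : cornerPoint ^ 10 = -cornerPoint ^ 4 := by linear_combination cornerPoint ^ 4 * h6
  simp only [unitPairs, Finset.mem_insert, Finset.mem_singleton] at hp
  rcases hp with rfl | rfl | rfl | rfl | rfl | rfl
  · rw [← orbitTerm_cornerPoint_pow k w 0]; congr 1; simp [linForm]
  · rw [← orbitTerm_cornerPoint_pow k w 6]; congr 1; rw [h6]; simp [linForm]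
  · rw [← orbitTerm_cornerPoint_pow k w 8]; congr 1; rw [h8]; simp [linForm]; linear_combination h2
  · rw [← orbitTerm_cornerPoint_pow k w 2]; congr 1; simp [linForm]; linear_combination -h2
  · rw [← orbitTerm_cornerPoint_pow k w 10]; congr 1; rw [h10]; simp [linForm]
    linear_combination h2 + h4
  · rw [← orbitTerm_cornerPoint_pow k w 4]; congr 1; simp [linForm]; linear_combination -h2 - h4

lemma pairNorm_pos {p : ℤ × ℤ} (hp : p ∈ admissiblePairs) : 0 < pairNorm p := by
  rcases pairNorm_eq_one_or_seven_le hp with h | h <;> omega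

lemma norm_linForm_cornerPoint_pow (m : ℕ) (p : ℤ × ℤ) :
    ‖linForm cornerPoint p‖ ^ (2 * m) = (pairNorm p : ℝ) ^ m := by
  rw [pow_mul, norm_linForm_cornerPoint_sq]

lemma linForm_cornerPoint_ne_zero {p : ℤ × ℤ} (hp : p ∈ admissiblePairs) :
    linForm cornerPoint p ≠ 0 := by
  intro h
  have h1 := norm_linForm_cornerPoint_sq p
  rw [h, norm_zero] at h1
  have h2 : (0 : ℝ) < pairNorm p := by exact_mod_cast pairNorm_pos hp
  norm_num at h1
  linarith

lemma norm_discTerm_le (m : ℕ) {w v : ℂ} (hw : ‖w‖ < 1) (hv : v ≠ 0) :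
    ‖discTerm (2 * m) w v‖ ≤ ((1 - ‖w‖) ^ (2 * m))⁻¹ * (‖v‖ ^ (2 * m))⁻¹ := by
  rw [discTerm, norm_inv, norm_pow, ← mul_inv, ← mul_pow]
  have hv' := norm_pos_iff.2 hv
  have h1 : (1 - ‖w‖) * ‖v‖ ≤ ‖v - conj v * w‖ := by
    have := norm_sub_norm_le v (conj v * w)
    rw [norm_mul, Complex.norm_conj] at this
    linarith
  have h2 : 0 < (1 - ‖w‖) * ‖v‖ := mul_pos (by linarith) hv'
  gcongr

lemma summable_discTerm_linForm {m : ℕ} (hS : Summable (normTail m)) {w c : ℂ} (hw : ‖w‖ < 1)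
    (hc : ‖c‖ = 1) : Summable (admissiblePairs.indicator
      fun p => discTerm (2 * m) w (c * linForm cornerPoint p)) := by
  refine summable_of_norm_le_pairNorm hS (C := ((1 - ‖w‖) ^ (2 * m))⁻¹) fun p hp => ?_
  have hc0 : c ≠ 0 := norm_ne_zero_iff.1 (by rw [hc]; norm_num)
  refine (norm_discTerm_le m hw (mul_ne_zero hc0 (linForm_cornerPoint_ne_zero hp))).trans ?_
  rw [norm_mul, hc, one_mul, norm_linForm_cornerPoint_pow]

lemma norm_cornerPoint : ‖cornerPoint‖ = 1 := by
  have h := cornerPoint_pow_twelve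
  have : ‖cornerPoint‖ ^ 12 = 1 := by rw [← norm_pow, h, norm_one]
  exact (pow_eq_one_iff_of_nonneg (norm_nonneg _) (by norm_num)).1 this

lemma norm_cornerPoint_pow (j : ℕ) : ‖cornerPoint ^ j‖ = 1 := by
  rw [norm_pow, norm_cornerPoint, one_pow]

/-- A form with real coefficients and value `v` at `ρ` has value `(v - v̄ w)/(1 - w)` at `s`. Of the
twelve rotations, the six even ones each reproduce the sum over `linForm` and the six odd ones the
sum over `dualForm`, hence the factor 6. -/
lemma six_mul_frickeSum_eq {m : ℕ} (hS : Summable (normTail m)) {w : ℂ} (hw : ‖w‖ < 1) :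
    6 * frickeSum (2 * m) ((cornerPoint - conj cornerPoint * w) / (1 - w)) =
      (1 - w) ^ (2 * m) * ∑' p, admissiblePairs.indicator
        (fun p => orbitTerm (2 * m) w (linForm cornerPoint p)) p := by
  have hw1 : 1 - w ≠ 0 := fun h => by
    rw [← sub_eq_zero.1 h, norm_one] at hw; exact lt_irrefl _ hw
  set g := discTerm (2 * m) w with hg
  have hlin : ∀ p, ((linForm ((cornerPoint - conj cornerPoint * w) / (1 - w)) p) ^ (2 * m))⁻¹ =
      (1 - w) ^ (2 * m) * g (linForm cornerPoint p) := by
    intro p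
    have : linForm ((cornerPoint - conj cornerPoint * w) / (1 - w)) p =
        (linForm cornerPoint p - conj (linForm cornerPoint p) * w) / (1 - w) := by
      simp only [linForm, map_add, map_mul, Complex.conj_ofReal, map_intCast]
      field_simp; ring
    rw [this, hg, discTerm, div_pow, inv_div, div_eq_mul_inv]
  have hdual : ∀ p, ((dualForm ((cornerPoint - conj cornerPoint * w) / (1 - w)) p) ^ (2 * m))⁻¹ =
      (1 - w) ^ (2 * m) * g (dualForm cornerPoint p) := by
    intro p
    have : dualForm ((cornerPoint - conj cornerPoint * w) / (1 - w)) p =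
        (dualForm cornerPoint p - conj (dualForm cornerPoint p) * w) / (1 - w) := by
      simp only [dualForm, map_add, map_mul, Complex.conj_ofReal, map_intCast]
      field_simp; ring
    rw [this, hg, discTerm, div_pow, inv_div, div_eq_mul_inv]
  have hsj : ∀ j : ℕ, Summable (admissiblePairs.indicator
      fun p => g (cornerPoint ^ j * linForm cornerPoint p)) := fun j =>
    summable_discTerm_linForm hS hw (norm_cornerPoint_pow j)
  have hs0 : Summable (admissiblePairs.indicator fun p => g (linForm cornerPoint p)) := by
    simpa using hsj 0
  have hs1 : Summable (admissiblePairs.indicator fun p => g (dualForm cornerPoint p)) := by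
    have h1 := hsj 1
    rw [← linToDual.summable_iff]
    refine h1.congr fun p => ?_
    exact indicator_apply_congr (linToDual_mem p).symm
      (by rw [pow_one, cornerPoint_mul_linForm]; rfl)
  have hF : frickeSum (2 * m) ((cornerPoint - conj cornerPoint * w) / (1 - w)) =
      (1 - w) ^ (2 * m) * (∑' p, admissiblePairs.indicator (fun p => g (linForm cornerPoint p)) p +
        ∑' p, admissiblePairs.indicator (fun p => g (dualForm cornerPoint p)) p) := by
    rw [← hs0.tsum_add hs1, ← tsum_mul_left]
    refine tsum_congr fun p => ?_
    by_cases hp : p ∈ admissiblePairs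
    · simp only [Set.indicator_of_mem hp, frickeTerm, hlin, hdual, mul_add]
    · simp only [Set.indicator_of_notMem hp, add_zero, mul_zero]
  have hO : ∑' p, admissiblePairs.indicator
      (fun p => orbitTerm (2 * m) w (linForm cornerPoint p)) p =
      ∑ j ∈ Finset.range 12, ∑' p, admissiblePairs.indicator
        (fun p => g (cornerPoint ^ j * linForm cornerPoint p)) p := by
    rw [← Summable.tsum_finsetSum fun j _ => hsj j]
    refine tsum_congr fun p => ?_
    by_cases hp : p ∈ admissiblePairs
    · simp only [Set.indicator_of_mem hp, orbitTerm, hg]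
    · simp only [Set.indicator_of_notMem hp, Finset.sum_const_zero]
  have he := fun j => tsum_cornerPoint_pow_even g j
  have ho := fun j => tsum_cornerPoint_pow_odd g j
  rw [hO, hF]
  simp only [Finset.sum_range_succ, Finset.sum_range_zero, zero_add]
  rw [he 0, he 1, he 2, he 3, he 4, he 5, ho 0, ho 1, ho 2, ho 3, ho 4, ho 5]
  ring

/-- With `H` the series of absolute values and `t` its `n`-th term, the unit pairs contribute at
least `72(2t - H)` in modulus and all other pairs at most `12 H T`. The hypothesis says exactly that
the first exceeds the second. -/
theorem frickeSum_ne_zero_of_orbitCoeff {m : ℕ} (hm : 1 ≤ m) {T : ℝ}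
    (hS : Summable (normTail m)) (hT : ∑' p, normTail m p ≤ T) {w : ℂ} (hw : ‖w‖ < 1) (n : ℕ)
    (hH : (∑' i, orbitCoeff m i * ‖w‖ ^ i) * (6 + T) < 12 * (orbitCoeff m n * ‖w‖ ^ n)) :
    frickeSum (2 * m) ((cornerPoint - conj cornerPoint * w) / (1 - w)) ≠ 0 := by
  intro h0
  have hw1 : 1 - w ≠ 0 := fun h => by
    rw [← sub_eq_zero.1 h, norm_one] at hw; exact lt_irrefl _ hw
  have h6 := six_mul_frickeSum_eq hS hw
  rw [h0, mul_zero] at h6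
  have hzero := (mul_eq_zero.1 h6.symm).resolve_left (pow_ne_zero _ hw1)
  set H := ∑' i, orbitCoeff m i * ‖w‖ ^ i with hHdef
  have hb : ∀ p ∈ admissiblePairs, ‖orbitTerm (2 * m) w (linForm cornerPoint p)‖ ≤
      12 * H * ((pairNorm p : ℝ) ^ m)⁻¹ := fun p hp => by
    rw [← norm_linForm_cornerPoint_pow]
    exact norm_orbitTerm_le hm hw (linForm_cornerPoint_ne_zero hp)
  rw [tsum_indicator_split unitPairs_subset mem_normTail_iff
    (summable_of_norm_le_pairNorm hS hb)] at hzero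
  have hU : ∑ p ∈ unitPairs, orbitTerm (2 * m) w (linForm cornerPoint p) =
      6 * orbitTerm (2 * m) w 1 := by
    rw [Finset.sum_congr rfl fun p hp => orbitTerm_of_mem_unitPairs (2 * m) w hp,
      Finset.sum_const, show unitPairs.card = 6 from rfl]
    simp
  have htail : ‖∑' p, {p : ℤ × ℤ | p ∈ admissiblePairs ∧ 7 ≤ pairNorm p}.indicator
      (fun p => orbitTerm (2 * m) w (linForm cornerPoint p)) p‖ ≤ 12 * H * ∑' p, normTail m p := by
    refine tsum_of_norm_bounded (hS.hasSum.mul_left _) fun p => ?_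
    rw [normTail]
    by_cases hp : p ∈ {p : ℤ × ℤ | p ∈ admissiblePairs ∧ 7 ≤ pairNorm p}
    · rw [Set.indicator_of_mem hp, Set.indicator_of_mem hp]
      exact hb p hp.1
    · rw [Set.indicator_of_notMem hp, Set.indicator_of_notMem hp]; simp
  have hHnn : 0 ≤ H := tsum_nonneg fun i =>
    mul_nonneg (orbitCoeff_nonneg m i) (pow_nonneg (norm_nonneg w) i)
  rw [hU] at hzero
  have h1 : ‖6 * orbitTerm (2 * m) w 1‖ ≤ 12 * H * T := by
    rw [eq_neg_of_add_eq_zero_left hzero, norm_neg]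
    exact htail.trans (mul_le_mul_of_nonneg_left hT (by positivity))
  rw [norm_mul] at h1
  have h2 := le_norm_orbitTerm_one hm hw n
  norm_num at h1
  linarith

/-! ### Dominance of the first surviving Taylor coefficient. -/

lemma orbitCoeff_choose_step {K i n : ℕ} (hn : n ≤ i) :
    ((i + 1 + K).choose K : ℝ) ≤ ((K : ℝ) + 1 + n) / (n + 1) * ((i + K).choose K : ℝ) := by
  have h : ((i + 1 + K).choose K) * (i + 1) = (i + K).choose K * (K + 1 + i) := by
    have := Nat.choose_succ_right_eq (i + 1 + K) i
    have h1 := Nat.add_one_mul_choose_eq (i + K) i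
    rw [show i + 1 + K = i + K + 1 by ring, Nat.choose_symm_of_eq_add (show i + K + 1 = K + (i + 1) by ring),
      Nat.choose_symm_of_eq_add (show i + K = K + i by ring), ← h1]
    ring
  have hR : ((i + 1 + K).choose K : ℝ) * (i + 1) = (i + K).choose K * (K + 1 + i) := by
    exact_mod_cast h
  have hni : (n : ℝ) ≤ i := by exact_mod_cast hn
  have hc : (0 : ℝ) ≤ (i + K).choose K := by positivity
  have hi : (0 : ℝ) < i + 1 := by positivity
  rw [eq_div_of_mul_eq hi.ne' hR, mul_div_assoc, mul_comm]
  refine mul_le_mul_of_nonneg_right ?_ hc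
  rw [div_le_div_iff₀ hi (by positivity)]
  have hK : (0 : ℝ) ≤ K := by positivity
  nlinarith

/-- The product `∏_{l<6} (k + n + l) / (n + 1 + l)`. -/
noncomputable def coeffRatio (k n : ℕ) : ℝ :=
  ∏ l ∈ Finset.range 6, ((k : ℝ) + n + l) / (n + 1 + l)

/-- Consecutive binomials have ratio `(k + i)/(i + 1)`, nonincreasing in `i`, so six steps from `i ≥
n` gain at most six steps from `n`. -/
lemma choose_add_six_le {k i n : ℕ} (hk : 1 ≤ k) (hn : n ≤ i) :
    ((i + 6 + (k - 1)).choose (k - 1) : ℝ) ≤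
      coeffRatio k n * ((i + (k - 1)).choose (k - 1) : ℝ) := by
  have hstep : ∀ r : ℕ, ((i + r + (k - 1)).choose (k - 1) : ℝ) ≤
      (∏ l ∈ Finset.range r, ((k : ℝ) + n + l) / (n + 1 + l)) *
        ((i + (k - 1)).choose (k - 1) : ℝ) := by
    intro r
    induction r with
    | zero => simp
    | succ r ih =>
      have h1 := orbitCoeff_choose_step (K := k - 1) (show n + r ≤ i + r by omega)
      have hk' : ((k - 1 : ℕ) : ℝ) = k - 1 := by rw [Nat.cast_sub hk]; simp
      rw [hk'] at h1
      rw [Finset.prod_range_succ]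
      refine h1.trans ?_
      have e : ((k : ℝ) - 1 + 1 + ((n + r : ℕ) : ℝ)) / (((n + r : ℕ) : ℝ) + 1) =
          ((k : ℝ) + n + r) / (n + 1 + r) := by push_cast; congr 1 <;> ring
      rw [e, mul_comm (∏ l ∈ Finset.range r, _), mul_assoc]
      exact mul_le_mul_of_nonneg_left ih (by positivity)
  exact hstep 6

/-- The nonzero terms sit at `n, n + 6, n + 12, …`. The first ratio is at most `y` and all later
ones at most `z`, which gives a geometric majorant. Allowing `n₀ < n` permits one bound for all
residues of `m`. -/
lemma tsum_orbitCoeff_le {m n n₀ : ℕ} (hm : 1 ≤ m) (hn : n < 6) (h6 : 6 ∣ m + n) (hn₀ : n₀ ≤ n)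
    {x y z : ℝ} (h0 : 0 ≤ x) (hy : x ^ 6 * coeffRatio (2 * m) n₀ ≤ y)
    (hz : x ^ 6 * coeffRatio (2 * m) (n₀ + 6) ≤ z) (hz1 : z < 1) :
    ∑' i, orbitCoeff m i * x ^ i ≤ (1 + y / (1 - z)) * (orbitCoeff m n * x ^ n) := by
  set t : ℕ → ℝ := fun j => orbitCoeff m (n + 6 * j) * x ^ (n + 6 * j) with ht
  have hinj : Function.Injective (fun j : ℕ => n + 6 * j) := fun a b h => by
    simp only at h; omega
  have htsum : ∑' i, orbitCoeff m i * x ^ i = ∑' j, t j := by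
    rw [← hinj.tsum_eq]
    intro i hi
    have : 6 ∣ m + i := by
      by_contra hcon
      exact hi (by simp [orbitCoeff, hcon])
    exact ⟨(i - n) / 6, by simp only; omega⟩
  have hcoef : ∀ j, orbitCoeff m (n + 6 * j) =
      ((n + 6 * j + (2 * m - 1)).choose (2 * m - 1) : ℝ) := fun j => by
    rw [orbitCoeff, if_pos (by omega)]
  have htnn : ∀ j, 0 ≤ t j := fun j => mul_nonneg (orbitCoeff_nonneg _ _) (pow_nonneg h0 _)
  have hstep : ∀ (j r : ℕ) (c : ℝ), r ≤ n + 6 * j → x ^ 6 * coeffRatio (2 * m) r ≤ c →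
      t (j + 1) ≤ c * t j := by
    intro j r c hr hc
    have h1 := choose_add_six_le (k := 2 * m) (by omega) hr
    rw [ht]
    simp only [hcoef]
    rw [show n + 6 * (j + 1) = n + 6 * j + 6 by ring, pow_add]
    calc _ ≤ (coeffRatio (2 * m) r * ((n + 6 * j + (2 * m - 1)).choose (2 * m - 1) : ℝ)) *
          (x ^ (n + 6 * j) * x ^ 6) := mul_le_mul_of_nonneg_right h1 (by positivity)
      _ = (x ^ 6 * coeffRatio (2 * m) r) *
          (((n + 6 * j + (2 * m - 1)).choose (2 * m - 1) : ℝ) * x ^ (n + 6 * j)) := by ring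
      _ ≤ _ := mul_le_mul_of_nonneg_right hc (by positivity)
  have hcr : ∀ r, 0 ≤ coeffRatio (2 * m) r := fun r =>
    Finset.prod_nonneg fun l _ => by positivity
  have hy0 : 0 ≤ y := le_trans (mul_nonneg (by positivity) (hcr _)) hy
  have hz0 : 0 ≤ z := le_trans (mul_nonneg (by positivity) (hcr _)) hz
  have hgeo : ∀ j, t (j + 1) ≤ (y * t 0) * z ^ j := by
    intro j
    induction j with
    | zero => simpa using hstep 0 n₀ y (by omega) hy
    | succ j ih =>
      refine (hstep (j + 1) (n₀ + 6) z (by omega) hz).trans ?_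
      rw [pow_succ']
      calc z * t (j + 1) ≤ z * ((y * t 0) * z ^ j) := mul_le_mul_of_nonneg_left ih hz0
        _ = _ := by ring
  have hgs : Summable fun j => (y * t 0) * z ^ j :=
    (summable_geometric_of_lt_one hz0 hz1).mul_left _
  have hts1 : Summable fun j => t (j + 1) :=
    Summable.of_nonneg_of_le (fun j => htnn _) hgeo hgs
  have hts : Summable t := (summable_nat_add_iff 1).1 hts1
  rw [htsum, hts.tsum_eq_zero_add]
  have := hts1.tsum_le_tsum hgeo hgs
  rw [tsum_mul_left, tsum_geometric_of_lt_one hz0 hz1] at this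
  have h00 : t 0 = orbitCoeff m n * x ^ n := by simp [ht]
  rw [← h00, add_mul, one_mul]
  calc _ ≤ t 0 + y * t 0 * (1 - z)⁻¹ := by linarith
    _ = _ := by rw [div_eq_mul_inv]; ring

theorem frickeSum_ne_zero_of_coeffRatio {m n n₀ : ℕ} (hm : 1 ≤ m) (hn : n < 6) (h6 : 6 ∣ m + n)
    (hn₀ : n₀ ≤ n) {T y z : ℝ} (hS : Summable (normTail m)) (hT : ∑' p, normTail m p ≤ T)
    {w : ℂ} (hw0 : w ≠ 0) (hw : ‖w‖ < 1)
    (hy : ‖w‖ ^ 6 * coeffRatio (2 * m) n₀ ≤ y)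
    (hz : ‖w‖ ^ 6 * coeffRatio (2 * m) (n₀ + 6) ≤ z) (hz1 : z < 1)
    (hlt : (1 + y / (1 - z)) * (6 + T) < 12) :
    frickeSum (2 * m) ((cornerPoint - conj cornerPoint * w) / (1 - w)) ≠ 0 := by
  refine frickeSum_ne_zero_of_orbitCoeff hm hS hT hw n ?_
  have h1 := tsum_orbitCoeff_le hm hn h6 hn₀ (norm_nonneg w) hy hz hz1
  have hpos : 0 < orbitCoeff m n * ‖w‖ ^ n := by
    rw [orbitCoeff, if_pos h6]
    have : 0 < (n + (2 * m - 1)).choose (2 * m - 1) := Nat.choose_pos (by omega)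
    have hw' := norm_pos_iff.2 hw0
    positivity
  have hT0 : 0 ≤ T := le_trans (tsum_nonneg (normTail_nonneg m)) hT
  calc _ ≤ (1 + y / (1 - z)) * (orbitCoeff m n * ‖w‖ ^ n) * (6 + T) :=
        mul_le_mul_of_nonneg_right h1 (by linarith)
    _ = (1 + y / (1 - z)) * (6 + T) * (orbitCoeff m n * ‖w‖ ^ n) := by ring
    _ < _ := mul_lt_mul_of_pos_right hlt hpos

/-! ### Coordinates on the left half-domain and the size of the disc coordinate. -/

/-- The disc coordinate centred at the corner. -/
noncomputable def discCoord (s : ℂ) : ℂ := (s - cornerPoint) / (s - conj cornerPoint)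

lemma sub_conj_cornerPoint_ne_zero {s : ℂ} (hs : 0 < s.im) : s - conj cornerPoint ≠ 0 := by
  intro h
  have := congrArg Complex.im h
  simp [cornerPoint] at this
  linarith

lemma one_sub_discCoord_ne_zero {s : ℂ} (hs : 0 < s.im) : 1 - discCoord s ≠ 0 := by
  have h := sub_conj_cornerPoint_ne_zero hs
  rw [discCoord, one_sub_div h]
  refine div_ne_zero (fun h0 => ?_) h
  have := congrArg Complex.im h0
  simp [cornerPoint] at this

lemma eq_of_discCoord {s : ℂ} (hs : 0 < s.im) :
    s = (cornerPoint - conj cornerPoint * discCoord s) / (1 - discCoord s) := by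
  have h := sub_conj_cornerPoint_ne_zero hs
  rw [eq_div_iff (one_sub_discCoord_ne_zero hs), discCoord]
  field_simp
  ring

/-- `s` lies over the left half of the fundamental domain, with `|s|² = 1 + e` and
`√3 Re s = -(3 - τ) / 2`. -/
structure DomainCoords (s : ℂ) (e τ : ℝ) : Prop where
  im_pos : 0 < s.im
  e_nonneg : 0 ≤ e
  τ_nonneg : 0 ≤ τ
  τ_le : τ ≤ 3
  normSq_eq : s.re ^ 2 + s.im ^ 2 = 1 + e
  re_eq : √3 * s.re = -(3 - τ) / 2

namespace DomainCoords

variable {s : ℂ} {e τ : ℝ}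

lemma re_sq (h : DomainCoords s e τ) : 12 * s.re ^ 2 = (3 - τ) ^ 2 := by
  have h1 := congrArg (· ^ 2) h.re_eq
  simp only [mul_pow, sqrt_three_sq] at h1
  linarith

lemma im_sq (h : DomainCoords s e τ) : 4 * s.im ^ 2 = 1 + 4 * e + 2 * τ - τ ^ 2 / 3 := by
  have h1 := h.re_sq
  have h2 := h.normSq_eq
  linarith

lemma normSq_sub_cornerPoint (h : DomainCoords s e τ) :
    Complex.normSq (s - cornerPoint) = (1 + 2 * e + τ) / 2 - s.im := by
  have h1 := h.re_eq
  have h2 := h.normSq_eq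
  have h3 := sqrt_three_sq
  rw [Complex.normSq_apply]
  simp [cornerPoint]
  linarith

lemma normSq_sub_conj_cornerPoint (h : DomainCoords s e τ) :
    Complex.normSq (s - conj cornerPoint) = (1 + 2 * e + τ) / 2 + s.im := by
  have h1 := h.re_eq
  have h2 := h.normSq_eq
  have h3 := sqrt_three_sq
  rw [Complex.normSq_apply]
  simp [cornerPoint]
  linarith

lemma norm_discCoord_sq (h : DomainCoords s e τ) :
    ‖discCoord s‖ ^ 2 * ((1 + 2 * e + τ) / 2 + s.im) = (1 + 2 * e + τ) / 2 - s.im := by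
  rw [← Complex.normSq_eq_norm_sq, discCoord, map_div₀, h.normSq_sub_cornerPoint,
    h.normSq_sub_conj_cornerPoint]
  have := h.im_pos
  have := h.e_nonneg
  have := h.τ_nonneg
  exact div_mul_cancel₀ _ (by positivity)

lemma norm_discCoord_lt_one (h : DomainCoords s e τ) : ‖discCoord s‖ < 1 := by
  have h1 := h.norm_discCoord_sq
  have := h.im_pos
  have := h.e_nonneg
  have := h.τ_nonneg
  by_contra hcon
  have h2 : 1 ≤ ‖discCoord s‖ ^ 2 := one_le_pow₀ (not_lt.1 hcon)
  nlinarith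

lemma discCoord_ne_zero (h : DomainCoords s e τ) (he : 0 < e) : discCoord s ≠ 0 := by
  intro h0
  have h1 := h.norm_discCoord_sq
  rw [h0, norm_zero] at h1
  have h2 := h.im_sq
  have := h.τ_nonneg
  have h3 : s.im = (1 + 2 * e + τ) / 2 := by linarith
  rw [h3] at h2
  nlinarith [mul_nonneg he.le h.τ_nonneg]

/-- Here `S = |s - ρ||s - ρ̄|`, so `|w| = S/|s - ρ̄|²`, and it remains to see `|s - ρ̄|² ≥ 1 + e +
2τ/3 ≥ 1 + S`. -/
lemma norm_discCoord_mul_le (h : DomainCoords s e τ) {S : ℝ} (hS : 0 ≤ S)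
    (hS2 : S ^ 2 = e ^ 2 + e * τ + τ ^ 2 / 3) : ‖discCoord s‖ * (1 + S) ≤ S := by
  have h1 := h.norm_discCoord_sq
  have h2 := h.im_sq
  have hi := h.im_pos
  have he := h.e_nonneg
  have ht := h.τ_nonneg
  have ht3 := h.τ_le
  set x := ‖discCoord s‖
  have hx : 0 ≤ x := norm_nonneg _
  set A := (1 + 2 * e + τ) / 2
  have hA : A = (1 + 2 * e + τ) / 2 := rfl
  have e1 : (x * (A + s.im)) ^ 2 = S ^ 2 := by
    calc (x * (A + s.im)) ^ 2 = (x ^ 2 * (A + s.im)) * (A + s.im) := by ring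
      _ = A ^ 2 - s.im ^ 2 := by rw [h1]; ring
      _ = S ^ 2 := by rw [hS2, hA]; linear_combination (-1 / 4 : ℝ) * h2
  have hApos : 0 ≤ A + s.im := by positivity
  have e2 : x * (A + s.im) = S := (pow_left_inj₀ (by positivity) hS two_ne_zero).1 e1
  have h3 : (1 + τ / 3) / 2 ≤ s.im := by
    refine (abs_le_of_sq_le_sq' ?_ hi.le).2
    nlinarith
  have h4 : S ≤ e + 2 * τ / 3 := by
    refine (abs_le_of_sq_le_sq' ?_ (by positivity)).2
    rw [hS2]; nlinarith [mul_nonneg he ht]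
  rw [← e2]
  refine mul_le_mul_of_nonneg_left ?_ hx
  rw [e2, hA]; linarith

lemma norm_discCoord_le (h : DomainCoords s e τ) {m : ℕ} (hm : 0 < m) {C : ℝ} (hC : 0 ≤ C)
    (hS : (m : ℝ) ^ 2 * (e ^ 2 + e * τ + τ ^ 2 / 3) ≤ C ^ 2) :
    ‖discCoord s‖ * (m + C) ≤ C := by
  have he := h.e_nonneg
  have ht := h.τ_nonneg
  set S := √(e ^ 2 + e * τ + τ ^ 2 / 3)
  have hS2 : S ^ 2 = e ^ 2 + e * τ + τ ^ 2 / 3 := Real.sq_sqrt (by positivity)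
  have h1 := h.norm_discCoord_mul_le (Real.sqrt_nonneg _) hS2
  have hm' : (0 : ℝ) < m := by exact_mod_cast hm
  have h2 : m * S ≤ C := by
    refine (abs_le_of_sq_le_sq' ?_ hC).2
    rw [mul_pow, hS2]; exact hS
  have h3 : ‖discCoord s‖ ≤ 1 := h.norm_discCoord_lt_one.le
  nlinarith [norm_nonneg (discCoord s)]

lemma norm_discCoord_le_of_im (h : DomainCoords s e τ) (him : s.im ≤ 6 / 5) :
    ‖discCoord s‖ ≤ 3 / 5 := by
  have h1 := h.norm_discCoord_sq
  have h2 := h.im_sq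
  have hi := h.im_pos
  have he := h.e_nonneg
  have ht := h.τ_nonneg
  have ht3 := h.τ_le
  have hhalf : 1 / 2 ≤ s.im := by nlinarith
  -- This is `|w|² ≤ 9/25` cleared of denominators. For small `Im s` the condition `e ≥ 0` keeps `τ`
  -- small; otherwise `τ ≤ 3` is enough.
  have hA : 16 * (1 + 2 * e + τ) ≤ 68 * s.im := by
    by_cases hc : s.im ≤ 71 / 100
    · have h3 : τ ≤ 4 * s.im ^ 2 - 1 := by nlinarith
      have h4 : τ ≤ 102 / 100 := by nlinarith
      nlinarith
    · nlinarith
  have h3 : ‖discCoord s‖ ^ 2 ≤ (3 / 5) ^ 2 := by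
    by_contra hcon
    nlinarith
  exact (abs_le_of_sq_le_sq' h3 (by norm_num)).2

end DomainCoords

/-! ### Nonvanishing near the corner. -/

lemma pow_six_mul_coeffRatio_zero_le {k : ℕ} {x c : ℝ} (hx : 0 ≤ x) (h : x * (k + 5 / 2) ≤ c) :
    x ^ 6 * coeffRatio k 0 ≤ c ^ 6 / 720 := by
  have hk : (0 : ℝ) ≤ k := by positivity
  have e : x ^ 6 * coeffRatio k 0 = (x ^ 2 * (k * (k + 5))) * (x ^ 2 * ((k + 1) * (k + 4))) *
      (x ^ 2 * ((k + 2) * (k + 3))) / 720 := by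
    simp only [coeffRatio, Finset.prod_range_succ, Finset.prod_range_zero]
    norm_num; ring
  have h2 : (x * (k + 5 / 2)) ^ 2 ≤ c ^ 2 := pow_le_pow_left₀ (by positivity) h 2
  have b : ∀ t : ℝ, t ≤ (k + 5 / 2) ^ 2 → x ^ 2 * t ≤ c ^ 2 := fun t ht =>
    le_trans (by rw [mul_pow]; exact mul_le_mul_of_nonneg_left ht (by positivity)) h2
  -- The six factors are paired symmetrically about `k + 5/2`; each product is at most its square.
  have b1 := b (k * (k + 5)) (by nlinarith)
  have b2 := b ((k + 1) * (k + 4)) (by nlinarith)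
  have b3 := b ((k + 2) * (k + 3)) (by nlinarith)
  rw [e, show c ^ 6 = c ^ 2 * c ^ 2 * c ^ 2 by ring]
  gcongr

lemma pow_six_mul_coeffRatio_six_le {k : ℕ} {x c : ℝ} (hx : 0 ≤ x) (h : x * (k + 17 / 2) ≤ c) :
    x ^ 6 * coeffRatio k 6 ≤ c ^ 6 / 665280 := by
  have hk : (0 : ℝ) ≤ k := by positivity
  have e : x ^ 6 * coeffRatio k 6 = (x ^ 2 * ((k + 6) * (k + 11))) *
      (x ^ 2 * ((k + 7) * (k + 10))) * (x ^ 2 * ((k + 8) * (k + 9))) / 665280 := by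
    simp only [coeffRatio, Finset.prod_range_succ, Finset.prod_range_zero]
    norm_num; ring
  have h2 : (x * (k + 17 / 2)) ^ 2 ≤ c ^ 2 := pow_le_pow_left₀ (by positivity) h 2
  have b : ∀ t : ℝ, t ≤ (k + 17 / 2) ^ 2 → x ^ 2 * t ≤ c ^ 2 := fun t ht =>
    le_trans (by rw [mul_pow]; exact mul_le_mul_of_nonneg_left ht (by positivity)) h2
  have b1 := b ((k + 6) * (k + 11)) (by nlinarith)
  have b2 := b ((k + 7) * (k + 10)) (by nlinarith)
  have b3 := b ((k + 8) * (k + 9)) (by nlinarith)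
  rw [e, show c ^ 6 = c ^ 2 * c ^ 2 * c ^ 2 by ring]
  gcongr

lemma coeffRatio_mul_le_of_le {k n : ℕ} {x c q : ℝ} (hx : 0 ≤ x) (hxc : x ≤ c)
    (h : c ^ 6 * coeffRatio k n ≤ q) : x ^ 6 * coeffRatio k n ≤ q := by
  refine le_trans (mul_le_mul_of_nonneg_right (pow_le_pow_left₀ hx hxc 6) ?_) h
  exact Finset.prod_nonneg fun l _ => by positivity

theorem frickeSum_two_ne_zero_near_corner {s : ℂ} {e τ : ℝ} (h : DomainCoords s e τ) (he : 0 < e)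
    (him : s.im ≤ 6 / 5) : frickeSum (2 * 2) s ≠ 0 := by
  rw [eq_of_discCoord h.im_pos]
  have hx := h.norm_discCoord_le_of_im him
  refine frickeSum_ne_zero_of_coeffRatio (n := 4) (n₀ := 4) (y := 2 / 5) (z := 1 / 5) (by norm_num)
    (by norm_num) (by norm_num) le_rfl normTail_two.1 normTail_two.2 (h.discCoord_ne_zero he)
    h.norm_discCoord_lt_one
    (coeffRatio_mul_le_of_le (norm_nonneg _) hx ?_)
    (coeffRatio_mul_le_of_le (norm_nonneg _) hx ?_) (by norm_num) (by norm_num) <;>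
  · simp only [coeffRatio, Finset.prod_range_succ, Finset.prod_range_zero]
    norm_num

theorem frickeSum_three_ne_zero_near_corner {s : ℂ} {e τ : ℝ} (h : DomainCoords s e τ) (he : 0 < e)
    (hS : (3 : ℝ) ^ 2 * (e ^ 2 + e * τ + τ ^ 2 / 3) ≤ 3 ^ 2) : frickeSum (2 * 3) s ≠ 0 := by
  rw [eq_of_discCoord h.im_pos]
  have hx : ‖discCoord s‖ ≤ 1 / 2 := by
    have := h.norm_discCoord_le (m := 3) (C := 3) (by norm_num) (by norm_num) hS
    push_cast at this; linarith
  refine frickeSum_ne_zero_of_coeffRatio (n := 3) (n₀ := 3) (y := 14 / 25) (z := 1 / 8)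
    (by norm_num) (by norm_num) (by norm_num) le_rfl normTail_three.1 normTail_three.2
    (h.discCoord_ne_zero he) h.norm_discCoord_lt_one
    (coeffRatio_mul_le_of_le (norm_nonneg _) hx ?_)
    (coeffRatio_mul_le_of_le (norm_nonneg _) hx ?_) (by norm_num) (by norm_num) <;>
  · simp only [coeffRatio, Finset.prod_range_succ, Finset.prod_range_zero]
    norm_num

theorem frickeSum_ne_zero_near_corner {m : ℕ} (hm : 4 ≤ m) {s : ℂ} {e τ : ℝ}
    (h : DomainCoords s e τ) (he : 0 < e)
    (hS : (m : ℝ) ^ 2 * (e ^ 2 + e * τ + τ ^ 2 / 3) ≤ (29 / 20) ^ 2) :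
    frickeSum (2 * m) s ≠ 0 := by
  rw [eq_of_discCoord h.im_pos]
  have hx := h.norm_discCoord_le (m := m) (by omega) (by norm_num) hS
  obtain ⟨hT1, hT2⟩ := normTail_of_three_le (show 3 ≤ m by omega)
  have hT3 : ∑' p, normTail m p ≤ 9 / 100 := by
    refine hT2.trans ?_
    have : ((7 : ℝ) ^ (m - 3))⁻¹ ≤ 1 := inv_le_one_of_one_le₀ (one_le_pow₀ (by norm_num))
    linarith
  have hx0 := norm_nonneg (discCoord s)
  set x := ‖discCoord s‖ with hxdef
  have hne := h.discCoord_ne_zero he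
  have hlt := h.norm_discCoord_lt_one
  by_cases h4 : m = 4
  · subst h4
    have hx' : x ≤ 29 / 109 := by push_cast at hx; linarith
    refine frickeSum_ne_zero_of_coeffRatio (n := 2) (n₀ := 2) (y := 1 / 5) (z := 1 / 5)
      (by norm_num) (by norm_num) (by norm_num) le_rfl hT1 hT3 hne hlt
      (coeffRatio_mul_le_of_le hx0 hx' ?_)
      (coeffRatio_mul_le_of_le hx0 hx' ?_) (by norm_num) (by norm_num) <;>
    · simp only [coeffRatio, Finset.prod_range_succ, Finset.prod_range_zero]
      norm_num
  by_cases h5 : m = 5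
  · subst h5
    have hx' : x ≤ 29 / 129 := by push_cast at hx; linarith
    refine frickeSum_ne_zero_of_coeffRatio (n := 1) (n₀ := 1) (y := 1 / 5) (z := 1 / 5)
      (by norm_num) (by norm_num) (by norm_num) le_rfl hT1 hT3 hne hlt
      (coeffRatio_mul_le_of_le hx0 hx' ?_)
      (coeffRatio_mul_le_of_le hx0 hx' ?_) (by norm_num) (by norm_num) <;>
    · simp only [coeffRatio, Finset.prod_range_succ, Finset.prod_range_zero]
      norm_num
  have h6 : (6 : ℝ) ≤ m := by exact_mod_cast (show 6 ≤ m by omega)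
  -- From here on `n` depends on `m` modulo 6, so the ratios are bounded from `n₀ = 0`. The bound
  -- `|w| ≤ C/(m + C)` with `C = 29/20` gives `|w|(2m + 5/2) ≤ 2C`, and `|w|(2m + 17/2) ≤ 4` once `m
  -- ≥ 6`.
  obtain ⟨n, hn, hn6⟩ : ∃ n < 6, 6 ∣ m + n := ⟨(6 - m % 6) % 6, by omega, by omega⟩
  refine frickeSum_ne_zero_of_coeffRatio (n := n) (n₀ := 0) (y := 83 / 100) (z := 1 / 100)
    (by omega) hn hn6 (Nat.zero_le _) hT1 hT3 hne hlt ?_ ?_ (by norm_num) (by norm_num)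
  · refine (pow_six_mul_coeffRatio_zero_le (c := 29 / 10) hx0 ?_).trans (by norm_num)
    push_cast; nlinarith
  · refine (pow_six_mul_coeffRatio_six_le (c := 4) hx0 ?_).trans (by norm_num)
    push_cast; nlinarith

/-! ### Away from the corner: the constant term against absolute values. -/

/-- The admissible pairs on which `absPairNorm` is one. -/
def mainPairs : Finset (ℤ × ℤ) :=
  {(0, 1), (0, -1), (1, 1), (-1, -1), (1, 2), (-1, -2), (1, -1), (-1, 1), (1, -2), (-1, 2)}

lemma mainPairs_subset : ∀ p ∈ mainPairs, p ∈ admissiblePairs := by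
  intro p hp
  simp only [mainPairs, Finset.mem_insert, Finset.mem_singleton] at hp
  rcases hp with rfl | rfl | rfl | rfl | rfl | rfl | rfl | rfl | rfl | rfl <;>
    exact ⟨by rw [Int.isCoprime_iff_gcd_eq_one]; decide, by decide⟩

lemma mem_absNormTail_iff (p : ℤ × ℤ) :
    p ∈ {p : ℤ × ℤ | p ∈ admissiblePairs ∧ 7 ≤ absPairNorm p} ↔
      p ∈ admissiblePairs ∧ p ∉ mainPairs := by
  refine and_congr_right fun hp => ⟨fun h hU => ?_, fun h => ?_⟩
  · simp only [mainPairs, Finset.mem_insert, Finset.mem_singleton] at hU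
    rcases hU with rfl | rfl | rfl | rfl | rfl | rfl | rfl | rfl | rfl | rfl <;> revert h <;> decide
  · refine (absPairNorm_eq_one_or_seven_le hp).resolve_left fun h1 => h ?_
    obtain ⟨a, b⟩ := p
    rcases absPairNorm_eq_or (a, b) with h' | h' <;> rw [h'] at h1 <;>
      have h2 := mem_of_pairNorm_eq_one h1
    · simp only [Finset.mem_insert, Finset.mem_singleton, Prod.mk.injEq] at h2
      rcases h2 with ⟨rfl, rfl⟩ | ⟨rfl, rfl⟩ | ⟨rfl, rfl⟩ | ⟨rfl, rfl⟩ | ⟨rfl, rfl⟩ | ⟨rfl, rfl⟩ <;>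
        decide
    · simp only [Finset.mem_insert, Finset.mem_singleton, Prod.mk.injEq, neg_eq_iff_eq_neg] at h2
      rcases h2 with ⟨rfl, rfl⟩ | ⟨rfl, rfl⟩ | ⟨rfl, rfl⟩ | ⟨rfl, rfl⟩ | ⟨rfl, rfl⟩ | ⟨rfl, rfl⟩ <;>
        decide

lemma sum_mainPairs_of_even {f : ℤ × ℤ → ℂ} (hf : ∀ a b, f (-a, -b) = f (a, b)) :
    ∑ p ∈ mainPairs, f p =
      2 * (f (0, 1) + f (1, 1) + f (1, 2) + f (1, -1) + f (1, -2)) := by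
  have h0 := hf 0 1
  have h1 := hf 1 1
  have h2 := hf 1 2
  have h3 := hf 1 (-1)
  have h4 := hf 1 (-2)
  simp only [neg_zero, neg_neg] at h0 h1 h2 h3 h4
  have : ∑ p ∈ mainPairs, f p = f (0, 1) + (f (0, -1) + (f (1, 1) + (f (-1, -1) + (f (1, 2) +
      (f (-1, -2) + (f (1, -1) + (f (-1, 1) + (f (1, -2) + f (-1, 2))))))))) := by
    unfold mainPairs
    repeat rw [Finset.sum_insert (by decide)]
    rw [Finset.sum_singleton]
  rw [this, h0, h1, h2, h3, h4]
  ring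

lemma summable_frickeTerm_of_im_pos {m : ℕ} (hm : 2 ≤ m) {s : ℂ} (hs : 0 < s.im) :
    Summable (frickeTerm (2 * m) s) := by
  have h3 : (0 : ℝ) < √3 := by positivity
  have h3' : ((√3 : ℝ) : ℂ) ≠ 0 := by exact_mod_cast h3.ne'
  have him : 0 < (s / ((√3 : ℝ) : ℂ)).im := by
    rw [Complex.div_ofReal_im]; positivity
  have := summable_frickeTerm hm ⟨s / ((√3 : ℝ) : ℂ), him⟩
  rwa [show ((√3 : ℝ) : ℂ) * ((⟨s / ((√3 : ℝ) : ℂ), him⟩ : UpperHalfPlane) : ℂ) = s from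
    mul_div_cancel₀ _ h3'] at this

lemma frickeTerm_neg (m : ℕ) (s : ℂ) (a b : ℤ) :
    frickeTerm (2 * m) s (-a, -b) = frickeTerm (2 * m) s (a, b) := by
  have h1 : linForm s (-a, -b) = -linForm s (a, b) := by simp [linForm]; ring
  have h2 : dualForm s (-a, -b) = -dualForm s (a, b) := by simp [dualForm]; ring
  rw [frickeTerm, frickeTerm, h1, h2, (even_two_mul m).neg_pow, (even_two_mul m).neg_pow]

namespace DomainCoords

variable {s : ℂ} {e τ : ℝ}

lemma norm_linForm_sq (h : DomainCoords s e τ) (p : ℤ × ℤ) :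
    ‖linForm s p‖ ^ 2 = 3 * p.1 ^ 2 * (1 + e) + p.2 ^ 2 - p.1 * p.2 * (3 - τ) := by
  have h1 := h.re_eq
  have h2 := h.normSq_eq
  rw [← Complex.normSq_eq_norm_sq, Complex.normSq_apply]
  simp only [linForm, Complex.add_re, Complex.add_im, Complex.mul_re, Complex.mul_im,
    Complex.ofReal_re, Complex.ofReal_im, Complex.intCast_re, Complex.intCast_im]
  linear_combination (p.1 : ℝ) ^ 2 * (s.re ^ 2 + s.im ^ 2) * sqrt_three_sq +
    3 * (p.1 : ℝ) ^ 2 * h2 + 2 * p.1 * p.2 * h1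

lemma norm_dualForm_sq (h : DomainCoords s e τ) (p : ℤ × ℤ) :
    ‖dualForm s p‖ ^ 2 = p.2 ^ 2 * (1 + e) + 3 * p.1 ^ 2 - p.1 * p.2 * (3 - τ) := by
  have h1 := h.re_eq
  have h2 := h.normSq_eq
  rw [← Complex.normSq_eq_norm_sq, Complex.normSq_apply]
  simp only [dualForm, Complex.add_re, Complex.add_im, Complex.mul_re, Complex.mul_im,
    Complex.ofReal_re, Complex.ofReal_im, Complex.intCast_re, Complex.intCast_im]
  linear_combination (p.1 : ℝ) ^ 2 * sqrt_three_sq +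
    (p.2 : ℝ) ^ 2 * h2 + 2 * p.1 * p.2 * h1

lemma mul_le_abs (h : DomainCoords s e τ) (p : ℤ × ℤ) :
    (p.1 : ℝ) * p.2 * (3 - τ) ≤ 3 * |(p.1 : ℝ) * p.2| := by
  have h1 := h.τ_nonneg
  have h2 := h.τ_le
  nlinarith [le_abs_self ((p.1 : ℝ) * p.2), abs_nonneg ((p.1 : ℝ) * p.2)]

/-- The form with `|ab|` is used because `ab` may have either sign and `τ` ranges over all of `[0,
3]`; the bound is uniform over the half-domain. -/
lemma absPairNorm_le_linForm (h : DomainCoords s e τ) (p : ℤ × ℤ) :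
    (absPairNorm p : ℝ) ≤ ‖linForm s p‖ ^ 2 := by
  rw [h.norm_linForm_sq, absPairNorm]
  push_cast
  have := h.mul_le_abs p
  have := mul_nonneg (sq_nonneg (p.1 : ℝ)) h.e_nonneg
  linarith

lemma absPairNorm_le_dualForm (h : DomainCoords s e τ) (p : ℤ × ℤ) :
    (absPairNorm p : ℝ) ≤ ‖dualForm s p‖ ^ 2 := by
  rw [h.norm_dualForm_sq, absPairNorm]
  push_cast
  have := h.mul_le_abs p
  have := mul_nonneg (sq_nonneg (p.2 : ℝ)) h.e_nonneg
  linarith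

end DomainCoords

lemma norm_inv_pow_le {v : ℂ} {N : ℝ} (hN : 0 < N) (h : N ≤ ‖v‖ ^ 2) (m : ℕ) :
    ‖(v ^ (2 * m))⁻¹‖ ≤ (N ^ m)⁻¹ := by
  rw [norm_inv, norm_pow, pow_mul]
  gcongr

/-- The bound `∑ (1 + ·)⁻ᵐ` for everything but the summands `1` and `s⁻ᵏ`. -/
noncomputable def remainderBound (m : ℕ) (e τ : ℝ) : ℝ :=
  ((1 + τ + e) ^ m)⁻¹ + ((1 + τ + 3 * e) ^ m)⁻¹ + ((1 + 2 * τ + 3 * e) ^ m)⁻¹ +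
    ((1 + 2 * τ + 4 * e) ^ m)⁻¹ + 2 * (4 ^ m)⁻¹ + 2 * (7 ^ m)⁻¹ + (7 ^ (m - 3))⁻¹ * (9 / 50)

namespace DomainCoords

variable {s : ℂ} {e τ : ℝ} {m : ℕ}

lemma norm_inv_forms (h : DomainCoords s e τ) :
    ‖(linForm s (1, 1) ^ (2 * m))⁻¹‖ ≤ ((1 + τ + 3 * e) ^ m)⁻¹ ∧
    ‖(dualForm s (1, 1) ^ (2 * m))⁻¹‖ ≤ ((1 + τ + e) ^ m)⁻¹ ∧
    ‖(linForm s (1, 2) ^ (2 * m))⁻¹‖ ≤ ((1 + 2 * τ + 3 * e) ^ m)⁻¹ ∧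
    ‖(dualForm s (1, 2) ^ (2 * m))⁻¹‖ ≤ ((1 + 2 * τ + 4 * e) ^ m)⁻¹ ∧
    ‖(linForm s (1, -1) ^ (2 * m))⁻¹‖ ≤ (4 ^ m)⁻¹ ∧
    ‖(dualForm s (1, -1) ^ (2 * m))⁻¹‖ ≤ (4 ^ m)⁻¹ ∧
    ‖(linForm s (1, -2) ^ (2 * m))⁻¹‖ ≤ (7 ^ m)⁻¹ ∧
    ‖(dualForm s (1, -2) ^ (2 * m))⁻¹‖ ≤ (7 ^ m)⁻¹ := by
  have he := h.e_nonneg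
  have ht := h.τ_nonneg
  have ht3 := h.τ_le
  refine ⟨?_, ?_, ?_, ?_, ?_, ?_, ?_, ?_⟩ <;>
  · refine norm_inv_pow_le (by positivity) ?_ m
    simp only [h.norm_linForm_sq, h.norm_dualForm_sq]
    push_cast
    linarith

lemma norm_tsum_tail_le {f : ℤ × ℤ → ℂ} {C : ℝ} (hm : 3 ≤ m) (hC : 0 ≤ C)
    (hf : ∀ p, 7 ≤ absPairNorm p → ‖f p‖ ≤ C * ((absPairNorm p : ℝ) ^ m)⁻¹) :
    ‖∑' p, {p : ℤ × ℤ | p ∈ admissiblePairs ∧ 7 ≤ absPairNorm p}.indicator f p‖ ≤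
      C * ((7 ^ (m - 3))⁻¹ * (9 / 50)) := by
  obtain ⟨hS, hT⟩ := absNormTail_of_three_le hm
  refine le_trans (tsum_of_norm_bounded (hS.hasSum.mul_left C) fun p => ?_)
    (mul_le_mul_of_nonneg_left hT hC)
  rw [absNormTail]
  by_cases hp : p ∈ {p : ℤ × ℤ | p ∈ admissiblePairs ∧ 7 ≤ absPairNorm p}
  · rw [Set.indicator_of_mem hp, Set.indicator_of_mem hp]
    exact hf p hp.2
  · rw [Set.indicator_of_notMem hp, Set.indicator_of_notMem hp]; simp

lemma norm_sq (h : DomainCoords s e τ) : ‖s‖ ^ 2 = 1 + e := by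
  rw [← Complex.normSq_eq_norm_sq, Complex.normSq_apply, ← h.normSq_eq]; ring

/-- After halving by `p ↦ -p`, a zero would write 1 as minus the sum of the other terms, whose
absolute values add up to less than 1. -/
theorem frickeSum_ne_zero_of_remainderBound (h : DomainCoords s e τ) (hm : 3 ≤ m)
    (hlt : ((1 + e) ^ m)⁻¹ + remainderBound m e τ < 1) : frickeSum (2 * m) s ≠ 0 := by
  intro h0
  have hsum := (summable_frickeTerm_of_im_pos (m := m) (by omega) h.im_pos).indicator admissiblePairs
  rw [frickeSum, tsum_indicator_split mainPairs_subset mem_absNormTail_iff hsum,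
    sum_mainPairs_of_even (frickeTerm_neg m s)] at h0
  obtain ⟨n1, n2, n3, n4, n5, n6, n7, n8⟩ := h.norm_inv_forms (m := m)
  have htail := norm_tsum_tail_le (f := frickeTerm (2 * m) s) (C := 2) hm (by norm_num)
    fun p hp => by
      have hpos : (0 : ℝ) < absPairNorm p := by exact_mod_cast lt_of_lt_of_le (by norm_num) hp
      have h1 := norm_inv_pow_le hpos (h.absPairNorm_le_linForm p) m
      have h2 := norm_inv_pow_le hpos (h.absPairNorm_le_dualForm p) m
      exact (norm_add_le _ _).trans (by linarith)
  have h01 : frickeTerm (2 * m) s (0, 1) = 1 + (s ^ (2 * m))⁻¹ := by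
    simp [frickeTerm, linForm, dualForm]
  have hs : ‖(s ^ (2 * m))⁻¹‖ ≤ ((1 + e) ^ m)⁻¹ :=
    norm_inv_pow_le (by linarith [h.e_nonneg]) h.norm_sq.ge m
  set T := ∑' p, {p : ℤ × ℤ | p ∈ admissiblePairs ∧ 7 ≤ absPairNorm p}.indicator
    (frickeTerm (2 * m) s) p
  have hone : (1 : ℂ) = -((s ^ (2 * m))⁻¹ + frickeTerm (2 * m) s (1, 1) +
      frickeTerm (2 * m) s (1, 2) + frickeTerm (2 * m) s (1, -1) +
      frickeTerm (2 * m) s (1, -2) + T / 2) := by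
    rw [h01] at h0
    linear_combination (1 / 2 : ℂ) * h0
  have hnorm := congrArg norm hone
  rw [norm_one, norm_neg] at hnorm
  have t1 : ∀ p, ‖frickeTerm (2 * m) s p‖ ≤ ‖(linForm s p ^ (2 * m))⁻¹‖ +
      ‖(dualForm s p ^ (2 * m))⁻¹‖ := fun p => norm_add_le _ _
  have hT2 : ‖T / 2‖ = ‖T‖ / 2 := by rw [norm_div]; norm_num
  have a1 := norm_add_le ((s ^ (2 * m))⁻¹ + frickeTerm (2 * m) s (1, 1) +
      frickeTerm (2 * m) s (1, 2) + frickeTerm (2 * m) s (1, -1) +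
      frickeTerm (2 * m) s (1, -2)) (T / 2)
  have a2 := norm_add_le ((s ^ (2 * m))⁻¹ + frickeTerm (2 * m) s (1, 1) +
      frickeTerm (2 * m) s (1, 2) + frickeTerm (2 * m) s (1, -1)) (frickeTerm (2 * m) s (1, -2))
  have a3 := norm_add_le ((s ^ (2 * m))⁻¹ + frickeTerm (2 * m) s (1, 1) +
      frickeTerm (2 * m) s (1, 2)) (frickeTerm (2 * m) s (1, -1))
  have a4 := norm_add_le ((s ^ (2 * m))⁻¹ + frickeTerm (2 * m) s (1, 1))
    (frickeTerm (2 * m) s (1, 2))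
  have a5 := norm_add_le ((s ^ (2 * m))⁻¹) (frickeTerm (2 * m) s (1, 1))
  have b1 := t1 (1, 1)
  have b2 := t1 (1, 2)
  have b3 := t1 (1, -1)
  have b4 := t1 (1, -2)
  unfold remainderBound at hlt
  linarith

end DomainCoords

/-! ### Close to the arc: real and imaginary parts separately. -/

lemma norm_pow_sub_pow_le {a b : ℂ} {M : ℝ} (ha : ‖a‖ ≤ M) (hb : ‖b‖ ≤ M) (n : ℕ) :
    ‖a ^ (n + 1) - b ^ (n + 1)‖ ≤ (n + 1) * M ^ n * ‖a - b‖ := by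
  have hM : 0 ≤ M := (norm_nonneg a).trans ha
  rw [← Commute.geom_sum₂_mul (Commute.all a b), norm_mul]
  refine mul_le_mul_of_nonneg_right ?_ (norm_nonneg _)
  refine (norm_sum_le _ _).trans ?_
  have : ∀ i ∈ Finset.range (n + 1), ‖a ^ i * b ^ (n + 1 - 1 - i)‖ ≤ M ^ n := by
    intro i hi
    rw [norm_mul, norm_pow, norm_pow]
    have hi' : i ≤ n := Nat.lt_succ_iff.1 (Finset.mem_range.1 hi)
    calc _ ≤ M ^ i * M ^ (n - i) := by
          rw [Nat.add_sub_cancel]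
          gcongr
      _ = M ^ n := by rw [← pow_add, Nat.add_sub_cancel' hi']
  refine (Finset.sum_le_sum this).trans (le_of_eq ?_)
  rw [Finset.sum_const, Finset.card_range, nsmul_eq_mul]
  push_cast; ring

lemma norm_inv_pow_sub_inv_pow_le {v u : ℂ} {N D : ℝ} (hN : 0 < N) (hv : N ≤ ‖v‖)
    (hu : N ≤ ‖u‖) (hD : ‖v - u‖ ≤ D) (n : ℕ) :
    ‖(v ^ (n + 1))⁻¹ - (u ^ (n + 1))⁻¹‖ ≤ (n + 1) * D / N * (N ^ (n + 1))⁻¹ := by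
  have hv0 : v ≠ 0 := norm_pos_iff.1 (hN.trans_le hv)
  have hu0 : u ≠ 0 := norm_pos_iff.1 (hN.trans_le hu)
  rw [← inv_pow, ← inv_pow]
  have h1 := norm_pow_sub_pow_le (a := v⁻¹) (b := u⁻¹) (M := N⁻¹)
    (by rw [norm_inv]; gcongr) (by rw [norm_inv]; gcongr) n
  refine h1.trans ?_
  have h2 : ‖v⁻¹ - u⁻¹‖ ≤ D * N⁻¹ * N⁻¹ := by
    rw [inv_sub_inv hv0 hu0, norm_div, norm_mul, norm_sub_rev, div_eq_mul_inv, mul_inv, mul_assoc]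
    have : 0 ≤ D := (norm_nonneg _).trans hD
    gcongr
  calc _ ≤ (n + 1) * N⁻¹ ^ n * (D * N⁻¹ * N⁻¹) := by gcongr
    _ = _ := by rw [← inv_pow, pow_succ]; ring

/-- With `r = eᵗ` this is `m sinh t ≤ sinh (m t)`; the induction step is superadditivity of `sinh`
on `t ≥ 0`. -/
lemma mul_sub_inv_le_pow_sub_inv_pow {r : ℝ} (hr : 1 ≤ r) (m : ℕ) :
    m * (r - r⁻¹) ≤ r ^ m - (r ^ m)⁻¹ := by
  induction m with
  | zero => simp
  | succ m ih =>
    have hr0 : 0 < r := by linarith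
    have h1 : 1 ≤ r ^ m := one_le_pow₀ hr
    have hi : r⁻¹ ≤ 1 := inv_le_one_of_one_le₀ hr
    have hpi : (r ^ m)⁻¹ ≤ 1 := inv_le_one_of_one_le₀ h1
    have key : (r - r⁻¹) + (r ^ m - (r ^ m)⁻¹) ≤ r ^ (m + 1) - (r ^ (m + 1))⁻¹ := by
      rw [pow_succ, mul_inv]
      set P := r ^ m
      have e : P * r - P⁻¹ * r⁻¹ - ((r - r⁻¹) + (P - P⁻¹)) =
          (P - 1) * (r - 1) - (1 - P⁻¹) * (1 - r⁻¹) := by ring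
      have : (1 - P⁻¹) * (1 - r⁻¹) ≤ (P - 1) * (r - 1) := by
        have hP0 : 0 < P := by positivity
        have i1 : 1 - P⁻¹ ≤ P - 1 := by
          rw [sub_le_sub_iff, ← sub_nonneg]
          have : P + P⁻¹ - (1 + 1) = (P - 1) ^ 2 / P := by field_simp; ring
          rw [this]; positivity
        have i2 : 1 - r⁻¹ ≤ r - 1 := by
          rw [sub_le_sub_iff, ← sub_nonneg]
          have : r + r⁻¹ - (1 + 1) = (r - 1) ^ 2 / r := by field_simp; ring
          rw [this]; positivity
        exact mul_le_mul i1 i2 (by linarith) (by linarith)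
      linarith
    push_cast
    linarith

namespace DomainCoords

variable {s : ℂ} {e τ : ℝ} {m : ℕ}

/-- On `|s| = 1` the two normalised forms are complex conjugates. In general, with `q = |σ|`, the
discrepancy is `(q² - 1)/(σ q²) · (√3 a s - b q²)`, so it vanishes to first order on the arc. -/
lemma normSq_linForm_sub_dualForm (h : DomainCoords s e τ) {σ : ℂ} (hσ : σ ^ 2 = s)
    (p : ℤ × ℤ) :
    ‖linForm s p / σ - conj (dualForm s p / σ)‖ ^ 2 * ‖σ‖ ^ 4 =
      (‖σ‖ ^ 2 - 1) ^ 2 * ((3 * p.1 ^ 2 + p.2 ^ 2) * ‖σ‖ ^ 2 + p.1 * p.2 * (3 - τ)) := by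
  have hs0 : s ≠ 0 := fun h0 => by have := h.im_pos; rw [h0] at this; simp at this
  have hσ0 : σ ≠ 0 := fun h0 => hs0 (by rw [← hσ, h0]; simp)
  set q := ‖σ‖ with hq
  have hq0 : 0 < q := norm_pos_iff.2 hσ0
  have hqC : ((q : ℝ) : ℂ) ≠ 0 := by exact_mod_cast hq0.ne'
  have hconj : conj σ * σ = (q : ℂ) ^ 2 := by
    rw [mul_comm, Complex.mul_conj, Complex.normSq_eq_norm_sq]; push_cast; rfl
  have hconj' : conj σ = (q : ℂ) ^ 2 / σ := by rw [← hconj]; field_simp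
  have hu : conj (dualForm s p / σ) =
      p.2 * (q : ℂ) ^ 2 / σ + ((√3 : ℝ) : ℂ) * p.1 * σ / (q : ℂ) ^ 2 := by
    simp only [dualForm, ← hσ, map_div₀, map_add, map_mul, map_pow, Complex.conj_ofReal,
      map_intCast, hconj']
    field_simp
  have hv : linForm s p / σ = ((√3 : ℝ) : ℂ) * p.1 * σ + p.2 / σ := by
    rw [linForm, ← hσ]; field_simp
  have hdiff : linForm s p / σ - conj (dualForm s p / σ) =
      ((q ^ 2 - 1 : ℝ) : ℂ) / (σ * ((q ^ 2 : ℝ) : ℂ)) *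
        (((√3 * p.1 : ℝ) : ℂ) * s - ((p.2 * q ^ 2 : ℝ) : ℂ)) := by
    rw [hu, hv, ← hσ]
    push_cast
    field_simp
    ring
  have hn : ‖((√3 * p.1 : ℝ) : ℂ) * s - ((p.2 * q ^ 2 : ℝ) : ℂ)‖ ^ 2 =
      q ^ 2 * ((3 * p.1 ^ 2 + p.2 ^ 2) * q ^ 2 + p.1 * p.2 * (3 - τ)) := by
    have hq4 : q ^ 4 = 1 + e := by
      rw [← h.norm_sq, ← hσ, norm_pow, ← hq]; ring
    rw [← Complex.normSq_eq_norm_sq, Complex.normSq_apply]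
    simp only [Complex.sub_re, Complex.sub_im, Complex.mul_re, Complex.mul_im, Complex.ofReal_re,
      Complex.ofReal_im]
    linear_combination (p.1 : ℝ) ^ 2 * (s.re ^ 2 + s.im ^ 2) * sqrt_three_sq +
      3 * (p.1 : ℝ) ^ 2 * (h.normSq_eq - hq4) - 2 * p.1 * p.2 * q ^ 2 * h.re_eq
  rw [hdiff, norm_mul, mul_pow, hn, norm_div, norm_mul, Complex.norm_real, Complex.norm_real,
    div_pow, mul_pow, Real.norm_eq_abs, Real.norm_eq_abs, sq_abs, sq_abs, ← hq]
  field_simp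

/-- With `v = linForm/σ` and `u` the conjugate of `dualForm/σ`, the imaginary part is that of `v⁻²ᵐ
- u⁻²ᵐ`. A mean-value estimate bounds it by `2m|v - u|` times a power, and the factor `2m(q² - 1)/q`
from `|v - u|` is at most `R - R⁻¹`. -/
lemma abs_im_frickeTerm_le (h : DomainCoords s e τ) (he : 0 < e) (hm : 1 ≤ m) {σ : ℂ}
    (hσ : σ ^ 2 = s) (p : ℤ × ℤ) {N ρ : ℝ} (hN : 0 < N) (hlin : N ≤ ‖linForm s p‖ ^ 2)
    (hdual : N ≤ ‖dualForm s p‖ ^ 2) (hρ : 0 ≤ ρ)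
    (hQ : (3 * p.1 ^ 2 + p.2 ^ 2) * ‖σ‖ ^ 2 + p.1 * p.2 * (3 - τ) ≤ ρ ^ 2 * N) :
    |(s ^ m * frickeTerm (2 * m) s p).im| ≤
      (‖s ^ m‖ - ‖s ^ m‖⁻¹) * (‖s ^ m‖ * (ρ * (N ^ m)⁻¹)) := by
  have hs0 : s ≠ 0 := fun h0 => by have := h.im_pos; rw [h0] at this; simp at this
  have hσ0 : σ ≠ 0 := fun h0 => hs0 (by rw [← hσ, h0]; simp)
  have hdecomp : s ^ m * frickeTerm (2 * m) s p = ((linForm s p / σ) ^ (2 * m))⁻¹ +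
      ((dualForm s p / σ) ^ (2 * m))⁻¹ := by
    rw [frickeTerm, ← hσ, ← pow_mul, div_pow, div_pow, inv_div, inv_div]
    ring
  set v := linForm s p / σ with hv
  set u := conj (dualForm s p / σ) with hu
  have hcu : ((dualForm s p / σ) ^ (2 * m))⁻¹ = conj ((u ^ (2 * m))⁻¹) := by
    rw [hu, map_inv₀, map_pow, Complex.conj_conj]
  have him : (s ^ m * frickeTerm (2 * m) s p).im = ((v ^ (2 * m))⁻¹ - (u ^ (2 * m))⁻¹).im := by
    rw [hdecomp, hcu, Complex.add_im, Complex.conj_im, Complex.sub_im, sub_eq_add_neg]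
  set q := ‖σ‖ with hq
  have hq0 : 0 < q := norm_pos_iff.2 hσ0
  have hsq : ‖s‖ = q ^ 2 := by rw [← hσ, norm_pow]
  have hq1 : 1 < q := by
    have h1 := h.norm_sq
    rw [hsq] at h1
    by_contra hcon
    have h2 : (q ^ 2) ^ 2 ≤ 1 := pow_le_one₀ (by positivity) (pow_le_one₀ hq0.le (not_lt.1 hcon))
    linarith
  set ν := √N / q with hν
  have hν0 : 0 < ν := div_pos (Real.sqrt_pos.2 hN) hq0
  have hν2 : ν ^ 2 = N / q ^ 2 := by rw [hν, div_pow, Real.sq_sqrt hN.le]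
  have hNv : ν ≤ ‖v‖ := by
    rw [hv, norm_div, ← hq, hν]
    exact div_le_div_of_nonneg_right (Real.sqrt_le_iff.2 ⟨norm_nonneg _, hlin⟩) hq0.le
  have hNu : ν ≤ ‖u‖ := by
    rw [hu, Complex.norm_conj, norm_div, ← hq, hν]
    exact div_le_div_of_nonneg_right (Real.sqrt_le_iff.2 ⟨norm_nonneg _, hdual⟩) hq0.le
  have hD : ‖v - u‖ ≤ (q ^ 2 - 1) / q * (ρ * ν) := by
    have h1 := h.normSq_linForm_sub_dualForm hσ p
    rw [← hq, ← hv, ← hu] at h1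
    have hq21 : 0 < q ^ 2 - 1 := by nlinarith
    refine (abs_le_of_sq_le_sq' ?_ (by positivity)).2
    have h2 : ‖v - u‖ ^ 2 * q ^ 4 ≤ (q ^ 2 - 1) ^ 2 * (ρ ^ 2 * N) := by
      rw [h1]; exact mul_le_mul_of_nonneg_left hQ (by positivity)
    have h3 : ((q ^ 2 - 1) / q * (ρ * ν)) ^ 2 * q ^ 4 = (q ^ 2 - 1) ^ 2 * (ρ ^ 2 * N) := by
      rw [mul_pow, mul_pow, hν2]; field_simp
    rw [← h3] at h2
    exact le_of_mul_le_mul_right h2 (by positivity)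
  have hmain := norm_inv_pow_sub_inv_pow_le hν0 hNv hNu hD (2 * m - 1)
  rw [show 2 * m - 1 + 1 = 2 * m by omega] at hmain
  have hcast : (((2 * m - 1 : ℕ) : ℝ) + 1) = 2 * m := by
    rw [Nat.cast_sub (by omega)]; push_cast; ring
  have hPn : ‖s ^ m‖ = (q ^ 2) ^ m := by rw [norm_pow, hsq]
  have hr := mul_sub_inv_le_pow_sub_inv_pow (r := q ^ 2) (by nlinarith) m
  rw [him, hPn]
  refine (Complex.abs_im_le_norm _).trans (hmain.trans ?_)
  rw [hcast]
  have e1 : (ν ^ (2 * m))⁻¹ = (q ^ 2) ^ m * (N ^ m)⁻¹ := by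
    rw [pow_mul, hν2, div_pow, inv_div, div_eq_mul_inv]
  have e2 : 2 * (m : ℝ) * ((q ^ 2 - 1) / q * (ρ * ν)) / ν = 2 * m * ((q ^ 2 - 1) / q) * ρ := by
    field_simp
  rw [e1, e2]
  have e3 : 2 * (m : ℝ) * ((q ^ 2 - 1) / q) ≤ (q ^ 2) ^ m - ((q ^ 2) ^ m)⁻¹ := by
    refine le_trans ?_ hr
    have : 2 * ((q ^ 2 - 1) / q) ≤ q ^ 2 - (q ^ 2)⁻¹ := by
      have e4 : q ^ 2 - (q ^ 2)⁻¹ - 2 * ((q ^ 2 - 1) / q) =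
          (q ^ 2 - 1) * (q - 1) ^ 2 / q ^ 2 := by field_simp; ring
      have : 0 ≤ (q ^ 2 - 1) * (q - 1) ^ 2 / q ^ 2 := by
        have : 0 ≤ q ^ 2 - 1 := by nlinarith
        positivity
      linarith
    calc 2 * (m : ℝ) * ((q ^ 2 - 1) / q) = m * (2 * ((q ^ 2 - 1) / q)) := by ring
      _ ≤ _ := mul_le_mul_of_nonneg_left this (by positivity)
  calc 2 * (m : ℝ) * ((q ^ 2 - 1) / q) * ρ * ((q ^ 2) ^ m * (N ^ m)⁻¹)
      = 2 * (m : ℝ) * ((q ^ 2 - 1) / q) * ((q ^ 2) ^ m * (ρ * (N ^ m)⁻¹)) := by ring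
    _ ≤ _ := mul_le_mul_of_nonneg_right e3 (by positivity)

/-- The bound for the imaginary part of the remainder. -/
noncomputable def imRemainderBound (m : ℕ) (e τ : ℝ) : ℝ :=
  53 / 20 * ((1 + τ + e) ^ m)⁻¹ + 361 / 100 * ((1 + 2 * τ + 3 * e) ^ m)⁻¹ +
    3 / 2 * (4 ^ m)⁻¹ + 3 / 2 * (7 ^ m)⁻¹ + 2 * ((7 ^ (m - 3))⁻¹ * (9 / 50))

lemma abs_im_frickeTerm_main_le (h : DomainCoords s e τ) (he : 0 < e) (hm : 1 ≤ m) {σ : ℂ}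
    (hσ : σ ^ 2 = s) :
    |(s ^ m * frickeTerm (2 * m) s (1, 1)).im| ≤
      (‖s ^ m‖ - ‖s ^ m‖⁻¹) * (‖s ^ m‖ * (53 / 20 * ((1 + τ + e) ^ m)⁻¹)) ∧
    |(s ^ m * frickeTerm (2 * m) s (1, 2)).im| ≤
      (‖s ^ m‖ - ‖s ^ m‖⁻¹) * (‖s ^ m‖ * (361 / 100 * ((1 + 2 * τ + 3 * e) ^ m)⁻¹)) ∧
    |(s ^ m * frickeTerm (2 * m) s (1, -1)).im| ≤
      (‖s ^ m‖ - ‖s ^ m‖⁻¹) * (‖s ^ m‖ * (3 / 2 * ((4 + e) ^ m)⁻¹)) ∧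
    |(s ^ m * frickeTerm (2 * m) s (1, -2)).im| ≤
      (‖s ^ m‖ - ‖s ^ m‖⁻¹) * (‖s ^ m‖ * (3 / 2 * ((7 + 3 * e) ^ m)⁻¹)) := by
  have ht := h.τ_nonneg
  have ht3 := h.τ_le
  have hr : ‖σ‖ ^ 2 ≤ 1 + e / 2 := by
    have h1 := h.norm_sq
    rw [← hσ, norm_pow] at h1
    refine (abs_le_of_sq_le_sq' ?_ (by positivity)).2
    nlinarith
  -- The constants `53/20` and `361/100` lie just above `√7` and `√13`, the values of `ρ` required
  -- at `e = τ = 0`.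
  refine ⟨?_, ?_, ?_, ?_⟩ <;>
  · refine h.abs_im_frickeTerm_le he hm hσ _ (by positivity) ?_ ?_ (by norm_num) ?_ <;>
    · simp only [h.norm_linForm_sq, h.norm_dualForm_sq]
      push_cast
      nlinarith

lemma abs_im_frickeTerm_tail_le (h : DomainCoords s e τ) (he : 0 < e) (he' : e ≤ 2 / 7)
    (hm : 1 ≤ m) {σ : ℂ} (hσ : σ ^ 2 = s) {p : ℤ × ℤ} (hp : 7 ≤ absPairNorm p) :
    |(s ^ m * frickeTerm (2 * m) s p).im| ≤
      (‖s ^ m‖ - ‖s ^ m‖⁻¹) * (‖s ^ m‖ * (4 * ((absPairNorm p : ℝ) ^ m)⁻¹)) := by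
  have hr : ‖σ‖ ^ 2 ≤ 8 / 7 := by
    have h1 := h.norm_sq
    rw [← hσ, norm_pow] at h1
    refine (abs_le_of_sq_le_sq' ?_ (by positivity)).2
    nlinarith
  have hr1 : 1 ≤ ‖σ‖ ^ 2 := by
    have h1 := h.norm_sq
    rw [← hσ, norm_pow] at h1
    nlinarith [sq_nonneg ‖σ‖]
  have hpos : (0 : ℝ) < absPairNorm p := by exact_mod_cast lt_of_lt_of_le (by norm_num) hp
  refine h.abs_im_frickeTerm_le he hm hσ p hpos (h.absPairNorm_le_linForm p)
    (h.absPairNorm_le_dualForm p) (by norm_num) ?_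
  have h1 := h.mul_le_abs p
  rw [absPairNorm]
  push_cast
  have hab : |(p.1 : ℝ) * p.2| = |(p.1 : ℝ)| * |(p.2 : ℝ)| := abs_mul _ _
  rw [hab] at h1 ⊢
  set a := |(p.1 : ℝ)|
  set b := |(p.2 : ℝ)|
  rw [← sq_abs (p.1 : ℝ), ← sq_abs (p.2 : ℝ)]
  have h2 : (3 * a ^ 2 + b ^ 2) * ‖σ‖ ^ 2 ≤ (3 * a ^ 2 + b ^ 2) * (8 / 7) :=
    mul_le_mul_of_nonneg_left hr (by positivity)
  -- This is the condition for `ρ = 4` with `|σ|² ≤ 8/7`, multiplied by 7. It holds because `2√3 ·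
  -- 104 > 357`, and it is why `e ≤ 2/7` is assumed.
  have h3 : 0 ≤ 104 * (3 * a ^ 2 + b ^ 2) - 357 * (a * b) := by
    nlinarith [sq_nonneg (b - 357 / 208 * a), sq_nonneg a]
  linarith

/-- At a zero, `Im (sᵐ + s⁻ᵐ) = Im sᵐ · (R - R⁻¹)/R`, and cancelling `R - R⁻¹ > 0` bounds `|Im
sᵐ|/R`. The real part carries the factor `1 + R⁻²` and is bounded by absolute values. With `R ≤ P`
the two squares add up to less than `R²`, a contradiction. -/
theorem frickeSum_ne_zero_of_imRemainderBound (h : DomainCoords s e τ) (hm : 3 ≤ m) (he : 0 < e)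
    (he' : e ≤ 2 / 7) {P : ℝ} (hP0 : 0 ≤ P) (hP : (1 + e) ^ m ≤ P ^ 2)
    (hlt : (P * imRemainderBound m e τ) ^ 2 +
      (remainderBound m e τ * (P ^ 2 / (P ^ 2 + 1))) ^ 2 < 1) : frickeSum (2 * m) s ≠ 0 := by
  intro h0
  obtain ⟨σ, hσ⟩ := IsAlgClosed.exists_pow_nat_eq s (n := 2) (by norm_num)
  have ht := h.τ_nonneg
  set f : ℤ × ℤ → ℂ := fun p => s ^ m * frickeTerm (2 * m) s p with hf
  have hsumf : Summable f := (summable_frickeTerm_of_im_pos (m := m) (by omega) h.im_pos).mul_left _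
  have h0' : ∑' p, admissiblePairs.indicator f p = 0 := by
    have : ∀ p, admissiblePairs.indicator f p =
        s ^ m * admissiblePairs.indicator (frickeTerm (2 * m) s) p := fun p => by
      rw [hf, Set.indicator_const_mul]
    rw [tsum_congr this, tsum_mul_left]
    rw [frickeSum] at h0
    rw [h0, mul_zero]
  rw [tsum_indicator_split mainPairs_subset mem_absNormTail_iff (hsumf.indicator _),
    sum_mainPairs_of_even fun a b => by rw [hf]; simp only [frickeTerm_neg]] at h0'
  set T := ∑' p, {p : ℤ × ℤ | p ∈ admissiblePairs ∧ 7 ≤ absPairNorm p}.indicator f p with hT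
  set R := ‖s ^ m‖ with hR
  have hs1 : 1 < ‖s‖ := by
    have h1 := h.norm_sq
    by_contra hcon
    have : ‖s‖ ^ 2 ≤ 1 := pow_le_one₀ (norm_nonneg _) (not_lt.1 hcon)
    linarith
  have hR1 : 1 < R := by rw [hR, norm_pow]; exact one_lt_pow₀ hs1 (by omega)
  have hR0 : 0 < R := by linarith
  have hR2 : R ^ 2 = (1 + e) ^ m := by rw [hR, norm_pow, ← h.norm_sq, ← pow_mul, ← pow_mul, mul_comm]
  have hRi : R⁻¹ < 1 := inv_lt_one_of_one_lt₀ hR1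
  obtain ⟨hS, hTail⟩ := absNormTail_of_three_le hm
  -- the imaginary part
  obtain ⟨i1, i2, i3, i4⟩ := h.abs_im_frickeTerm_main_le he (m := m) (by omega) hσ
  have hTim : |T.im| ≤ (R - R⁻¹) * (R * 4) * ((7 ^ (m - 3))⁻¹ * (9 / 50)) := by
    have hC : 0 ≤ (R - R⁻¹) * (R * 4) := mul_nonneg (by linarith) (by linarith)
    rw [hT, Complex.im_tsum (hsumf.indicator _), ← Real.norm_eq_abs]
    refine le_trans (tsum_of_norm_bounded (hS.hasSum.mul_left _) fun p => ?_)
      (mul_le_mul_of_nonneg_left hTail hC)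
    rw [absNormTail]
    by_cases hp : p ∈ {p : ℤ × ℤ | p ∈ admissiblePairs ∧ 7 ≤ absPairNorm p}
    · rw [Set.indicator_of_mem hp, Set.indicator_of_mem hp, Real.norm_eq_abs]
      refine (h.abs_im_frickeTerm_tail_le he he' (by omega) hσ hp.2).trans (le_of_eq ?_)
      rw [← hR]; ring
    · rw [Set.indicator_of_notMem hp, Set.indicator_of_notMem hp]; simp
  have hs0 : s ^ m ≠ 0 := norm_pos_iff.1 (hR ▸ hR0)
  have hf01 : f (0, 1) = s ^ m + (s ^ m)⁻¹ := by
    simp only [hf, frickeTerm, linForm, dualForm]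
    push_cast
    have hsq : s ^ (2 * m) = s ^ m * s ^ m := by rw [two_mul, pow_add]
    simp only [mul_zero, zero_mul, zero_add, one_pow, inv_one, one_mul,
      add_zero, hsq]
    rw [mul_inv, mul_add, mul_one, ← mul_assoc, mul_inv_cancel₀ hs0, one_mul]
  have hfim : (f (0, 1)).im = (s ^ m).im * (1 - (R ^ 2)⁻¹) := by
    rw [hf01, Complex.add_im, Complex.inv_im, Complex.normSq_eq_norm_sq]
    rw [← hR]; ring
  have hfre : (f (0, 1)).re = (s ^ m).re * (1 + (R ^ 2)⁻¹) := by
    rw [hf01, Complex.add_re, Complex.inv_re, Complex.normSq_eq_norm_sq]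
    rw [← hR]; ring
  have him := congrArg Complex.im h0'
  have hre := congrArg Complex.re h0'
  have hC : 0 ≤ (R - R⁻¹) * R := mul_nonneg (by linarith) hR0.le
  have hIm : |(s ^ m).im| ≤ R * (R * imRemainderBound m e τ) := by
    have e1 : (f (0, 1)).im = -((f (1, 1)).im + (f (1, 2)).im + (f (1, -1)).im + (f (1, -2)).im +
        T.im / 2) := by
      simp only [Complex.add_im, Complex.mul_im, Complex.re_ofNat, Complex.im_ofNat, zero_mul,
        add_zero, Complex.zero_im] at him
      linarith
    have j3 : |(f (1, -1)).im| ≤ (R - R⁻¹) * (R * (3 / 2 * (4 ^ m)⁻¹)) := by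
      refine i3.trans ?_
      have : ((4 + e) ^ m)⁻¹ ≤ ((4 : ℝ) ^ m)⁻¹ := by gcongr; linarith
      have := mul_le_mul_of_nonneg_left this hC
      linarith
    have j4 : |(f (1, -2)).im| ≤ (R - R⁻¹) * (R * (3 / 2 * (7 ^ m)⁻¹)) := by
      refine i4.trans ?_
      have : ((7 + 3 * e) ^ m)⁻¹ ≤ ((7 : ℝ) ^ m)⁻¹ := by gcongr; linarith
      have := mul_le_mul_of_nonneg_left this hC
      linarith
    have e2 : |(f (0, 1)).im| ≤ (R - R⁻¹) * (R * imRemainderBound m e τ) := by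
      rw [e1, abs_neg]
      have a1 := abs_add_le ((f (1, 1)).im + (f (1, 2)).im + (f (1, -1)).im + (f (1, -2)).im)
        (T.im / 2)
      have a2 := abs_add_le ((f (1, 1)).im + (f (1, 2)).im + (f (1, -1)).im) (f (1, -2)).im
      have a3 := abs_add_le ((f (1, 1)).im + (f (1, 2)).im) (f (1, -1)).im
      have a4 := abs_add_le (f (1, 1)).im (f (1, 2)).im
      have a5 : |T.im / 2| = |T.im| / 2 := by rw [abs_div]; norm_num
      rw [imRemainderBound]
      linarith only [a1, a2, a3, a4, a5, i1, i2, j3, j4, hTim]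
    have e3 : 1 - (R ^ 2)⁻¹ = (R - R⁻¹) / R := by field_simp
    have e4 : 0 < (R - R⁻¹) / R := div_pos (by linarith) hR0
    rw [hfim, e3, abs_mul, abs_of_pos e4] at e2
    have e5 : (R - R⁻¹) * (R * imRemainderBound m e τ) =
        R * (R * imRemainderBound m e τ) * ((R - R⁻¹) / R) := by field_simp
    rw [e5] at e2
    exact le_of_mul_le_mul_right e2 e4
  -- the real part
  obtain ⟨n1, n2, n3, n4, n5, n6, n7, n8⟩ := h.norm_inv_forms (m := m)
  have hTre := norm_tsum_tail_le (f := f) (C := 2 * R) hm (by linarith)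
    fun p hp => by
      have hpos : (0 : ℝ) < absPairNorm p := by exact_mod_cast lt_of_lt_of_le (by norm_num) hp
      have h1 := norm_inv_pow_le hpos (h.absPairNorm_le_linForm p) m
      have h2 := norm_inv_pow_le hpos (h.absPairNorm_le_dualForm p) m
      have h3 : ‖frickeTerm (2 * m) s p‖ ≤ 2 * ((absPairNorm p : ℝ) ^ m)⁻¹ :=
        (norm_add_le _ _).trans (by linarith)
      rw [hf, norm_mul, ← hR]
      linarith [mul_le_mul_of_nonneg_left h3 hR0.le]
  rw [← hT] at hTre
  have hRe : |(s ^ m).re| ≤ R * (remainderBound m e τ * (R ^ 2 / (R ^ 2 + 1))) := by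
    have e1 : (f (0, 1)).re = -((f (1, 1)).re + (f (1, 2)).re + (f (1, -1)).re + (f (1, -2)).re +
        T.re / 2) := by
      simp only [Complex.add_re, Complex.mul_re, Complex.re_ofNat, Complex.im_ofNat, zero_mul,
        sub_zero, Complex.zero_re] at hre
      linarith
    have t1 : ∀ p, |(f p).re| ≤ R * (‖(linForm s p ^ (2 * m))⁻¹‖ +
        ‖(dualForm s p ^ (2 * m))⁻¹‖) := fun p => by
      refine (Complex.abs_re_le_norm _).trans ?_
      rw [hf, norm_mul, ← hR]
      exact mul_le_mul_of_nonneg_left (norm_add_le _ _) hR0.le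
    have e2 : |(f (0, 1)).re| ≤ R * remainderBound m e τ := by
      rw [e1, abs_neg]
      have a1 := abs_add_le ((f (1, 1)).re + (f (1, 2)).re + (f (1, -1)).re + (f (1, -2)).re)
        (T.re / 2)
      have a2 := abs_add_le ((f (1, 1)).re + (f (1, 2)).re + (f (1, -1)).re) (f (1, -2)).re
      have a3 := abs_add_le ((f (1, 1)).re + (f (1, 2)).re) (f (1, -1)).re
      have a4 := abs_add_le (f (1, 1)).re (f (1, 2)).re
      have a5 : |T.re / 2| = |T.re| / 2 := by rw [abs_div]; norm_num
      have a6 := Complex.abs_re_le_norm T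
      have b1 := (t1 (1, 1)).trans (mul_le_mul_of_nonneg_left (add_le_add n1 n2) hR0.le)
      have b2 := (t1 (1, 2)).trans (mul_le_mul_of_nonneg_left (add_le_add n3 n4) hR0.le)
      have b3 := (t1 (1, -1)).trans (mul_le_mul_of_nonneg_left (add_le_add n5 n6) hR0.le)
      have b4 := (t1 (1, -2)).trans (mul_le_mul_of_nonneg_left (add_le_add n7 n8) hR0.le)
      rw [remainderBound]
      linarith only [a1, a2, a3, a4, a5, a6, b1, b2, b3, b4, hTre]
    have e4 : 0 < 1 + (R ^ 2)⁻¹ := by positivity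
    rw [hfre, abs_mul, abs_of_pos e4] at e2
    have e5 : R * remainderBound m e τ =
        R * (remainderBound m e τ * (R ^ 2 / (R ^ 2 + 1))) * (1 + (R ^ 2)⁻¹) := by field_simp
    rw [e5] at e2
    exact le_of_mul_le_mul_right e2 e4
  have he0 := h.e_nonneg
  have hI0 : 0 ≤ imRemainderBound m e τ := by unfold imRemainderBound; positivity
  have hW0 : 0 ≤ remainderBound m e τ := by unfold remainderBound; positivity
  have hRP : R ≤ P := (abs_le_of_sq_le_sq' (by rw [hR2]; exact hP) hP0).2
  have hquot : R ^ 2 / (R ^ 2 + 1) ≤ P ^ 2 / (P ^ 2 + 1) := by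
    rw [div_le_div_iff₀ (by positivity) (by positivity)]
    have := pow_le_pow_left₀ hR0.le hRP 2
    linarith only [this]
  have hns : (s ^ m).re ^ 2 + (s ^ m).im ^ 2 = R ^ 2 := by
    rw [hR, ← Complex.normSq_eq_norm_sq, Complex.normSq_apply]; ring
  have q1 : (s ^ m).re ^ 2 ≤ R ^ 2 * (remainderBound m e τ * (P ^ 2 / (P ^ 2 + 1))) ^ 2 := by
    rw [← sq_abs, ← mul_pow]
    refine pow_le_pow_left₀ (abs_nonneg _) (hRe.trans ?_) 2
    gcongr
  have q2 : (s ^ m).im ^ 2 ≤ R ^ 2 * (P * imRemainderBound m e τ) ^ 2 := by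
    rw [← sq_abs, ← mul_pow]
    refine pow_le_pow_left₀ (abs_nonneg _) (hIm.trans ?_) 2
    gcongr
  have hRsq : 0 < R ^ 2 := by positivity
  have := mul_lt_mul_of_pos_left hlt hRsq
  linarith only [this, q1, q2, hns]

end DomainCoords

/-! ### Reduction to a smallest weight and the numerical case analysis. -/

lemma one_add_pow_le_one_add_pow {m₀ m : ℕ} {x₀ x : ℝ} (hm₀ : 0 < m₀) (hm : m₀ ≤ m) (h0 : 0 ≤ x₀)
    (hx : m₀ * x₀ ≤ m * x) : (1 + x₀) ^ m₀ ≤ (1 + x) ^ m := by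
  have hm₀' : (0 : ℝ) < m₀ := by exact_mod_cast hm₀
  have hm' : (0 : ℝ) < m := by exact_mod_cast hm₀.trans_le hm
  have hx0 : 0 ≤ x := by
    have : 0 ≤ m * x := le_trans (by positivity) hx
    exact nonneg_of_mul_nonneg_right this hm'
  have h1 := one_add_mul_self_le_rpow_one_add (s := x) (p := (m : ℝ) / m₀) (by linarith)
    (by rw [le_div_iff₀ hm₀', one_mul]; exact_mod_cast hm)
  have h2 : 1 + x₀ ≤ (1 + x) ^ ((m : ℝ) / m₀) := by
    refine le_trans ?_ h1
    have : x₀ ≤ m / m₀ * x := by rw [div_mul_eq_mul_div, le_div_iff₀ hm₀']; linarith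
    linarith
  calc (1 + x₀) ^ m₀ ≤ ((1 + x) ^ ((m : ℝ) / m₀)) ^ m₀ := by gcongr
    _ = (1 + x) ^ m := by
      rw [← Real.rpow_natCast, ← Real.rpow_mul (by linarith), div_mul_cancel₀ _ hm₀'.ne',
        Real.rpow_natCast]

/-- Since `(1 + x/m)ᵐ` increases in both `m` and `x`, lower bounds on `m e` and `m τ` allow every
term to be evaluated at `m₀`. -/
lemma remainderBound_anti {m₀ m : ℕ} {e₀ τ₀ e τ : ℝ} (hm₀ : 0 < m₀) (hm : m₀ ≤ m) (he₀ : 0 ≤ e₀)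
    (hτ₀ : 0 ≤ τ₀) (he : m₀ * e₀ ≤ m * e) (hτ : m₀ * τ₀ ≤ m * τ) :
    remainderBound m e τ ≤ remainderBound m₀ e₀ τ₀ := by
  have key : ∀ i j : ℝ, 0 ≤ i → 0 ≤ j →
      ((1 + i * τ + j * e) ^ m)⁻¹ ≤ ((1 + i * τ₀ + j * e₀) ^ m₀)⁻¹ := by
    intro i j hi hj
    have h := one_add_pow_le_one_add_pow (x₀ := i * τ₀ + j * e₀) (x := i * τ + j * e) hm₀ hm
      (by positivity) (by linarith [mul_le_mul_of_nonneg_left he hj,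
        mul_le_mul_of_nonneg_left hτ hi])
    rw [← add_assoc, ← add_assoc] at h
    have hpos : 0 < 1 + i * τ₀ + j * e₀ := by positivity
    gcongr
  have k1 := key 1 1 (by norm_num) (by norm_num)
  have k2 := key 1 3 (by norm_num) (by norm_num)
  have k3 := key 2 3 (by norm_num) (by norm_num)
  have k4 := key 2 4 (by norm_num) (by norm_num)
  have k5 := inv_pow_le_inv_pow_of_le (a := (4 : ℝ)) (by norm_num) hm
  have k6 := inv_pow_le_inv_pow_of_le (a := (7 : ℝ)) (by norm_num) hm
  have k7 := inv_pow_le_inv_pow_of_le (a := (7 : ℝ)) (by norm_num) (Nat.sub_le_sub_right hm 3)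
  simp only [one_mul] at k1 k2
  unfold remainderBound
  linarith

/-- Converts "outside the corner region and `m e ≤ a₁`" into a lower bound on `m τ`. -/
lemma le_of_quadratic {a b a₁ b₀ C : ℝ} (ha : 0 ≤ a) (hb : 0 ≤ b) (ha₁ : a ≤ a₁)
    (hC : a₁ ^ 2 + a₁ * b₀ + b₀ ^ 2 / 3 ≤ C) (hS : C < a ^ 2 + a * b + b ^ 2 / 3) : b₀ ≤ b := by
  by_contra! hcon
  have h1 : a ^ 2 ≤ a₁ ^ 2 := by gcongr
  have h2 : a * b ≤ a₁ * b₀ := by gcongr; linarith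
  have h3 : b ^ 2 ≤ b₀ ^ 2 := by gcongr
  linarith

namespace DomainCoords

lemma imRemainderBound_anti {m₀ m : ℕ} {e₀ τ₀ e τ : ℝ} (hm₀ : 0 < m₀) (hm : m₀ ≤ m)
    (he₀ : 0 ≤ e₀) (hτ₀ : 0 ≤ τ₀) (he : m₀ * e₀ ≤ m * e) (hτ : m₀ * τ₀ ≤ m * τ) :
    imRemainderBound m e τ ≤ imRemainderBound m₀ e₀ τ₀ := by
  have key : ∀ i j : ℝ, 0 ≤ i → 0 ≤ j →
      ((1 + i * τ + j * e) ^ m)⁻¹ ≤ ((1 + i * τ₀ + j * e₀) ^ m₀)⁻¹ := by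
    intro i j hi hj
    have h := one_add_pow_le_one_add_pow (x₀ := i * τ₀ + j * e₀) (x := i * τ + j * e) hm₀ hm
      (by positivity) (by linarith [mul_le_mul_of_nonneg_left he hj,
        mul_le_mul_of_nonneg_left hτ hi])
    rw [← add_assoc, ← add_assoc] at h
    have hpos : 0 < 1 + i * τ₀ + j * e₀ := by positivity
    gcongr
  have k1 := key 1 1 (by norm_num) (by norm_num)
  have k3 := key 2 3 (by norm_num) (by norm_num)
  have k5 := inv_pow_le_inv_pow_of_le (a := (4 : ℝ)) (by norm_num) hm
  have k6 := inv_pow_le_inv_pow_of_le (a := (7 : ℝ)) (by norm_num) hm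
  have k7 := inv_pow_le_inv_pow_of_le (a := (7 : ℝ)) (by norm_num) (Nat.sub_le_sub_right hm 3)
  simp only [one_mul] at k1
  unfold imRemainderBound
  linarith

variable {s : ℂ} {e τ : ℝ} {m m₀ : ℕ}

lemma frickeSum_ne_zero_of_large_e (h : DomainCoords s e τ) (hm₀ : 3 ≤ m₀) (hm : m₀ ≤ m)
    {e₀ τ₀ : ℝ} (he₀ : 0 ≤ e₀) (hτ₀ : 0 ≤ τ₀) (he : m₀ * e₀ ≤ m * e) (hτ : m₀ * τ₀ ≤ m * τ)
    (hlt : ((1 + e₀) ^ m₀)⁻¹ + remainderBound m₀ e₀ τ₀ < 1) : frickeSum (2 * m) s ≠ 0 := by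
  refine h.frickeSum_ne_zero_of_remainderBound (hm₀.trans hm) (lt_of_le_of_lt (add_le_add ?_
    (remainderBound_anti (by omega) hm he₀ hτ₀ he hτ)) hlt)
  have := one_add_pow_le_one_add_pow (by omega) hm he₀ he
  gcongr

lemma frickeSum_ne_zero_of_small_e (h : DomainCoords s e τ) (hpos : 0 < e) (he' : e ≤ 2 / 7)
    (hm₀ : 3 ≤ m₀) (hm : m₀ ≤ m) {P e₀ τ₀ : ℝ} (hP0 : 0 ≤ P) (hP : (1 + e) ^ m ≤ P ^ 2)
    (he₀ : 0 ≤ e₀) (hτ₀ : 0 ≤ τ₀) (he : m₀ * e₀ ≤ m * e) (hτ : m₀ * τ₀ ≤ m * τ)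
    (hlt : (P * imRemainderBound m₀ e₀ τ₀) ^ 2 +
      (remainderBound m₀ e₀ τ₀ * (P ^ 2 / (P ^ 2 + 1))) ^ 2 < 1) : frickeSum (2 * m) s ≠ 0 := by
  refine h.frickeSum_ne_zero_of_imRemainderBound (hm₀.trans hm) hpos he' hP0 hP
    (lt_of_le_of_lt ?_ hlt)
  have h1 := imRemainderBound_anti (by omega) hm he₀ hτ₀ he hτ
  have h2 := remainderBound_anti (by omega) hm he₀ hτ₀ he hτ
  have ht := h.τ_nonneg
  have hI0 : 0 ≤ imRemainderBound m e τ := by unfold imRemainderBound; positivity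
  have hW0 : 0 ≤ remainderBound m e τ := by unfold remainderBound; positivity
  gcongr

theorem frickeSum_three_ne_zero_away_corner (h : DomainCoords s e τ) (hpos : 0 < e)
    (hS : (3 : ℝ) ^ 2 < 3 ^ 2 * (e ^ 2 + e * τ + τ ^ 2 / 3)) : frickeSum (2 * 3) s ≠ 0 := by
  have ht := h.τ_nonneg
  have hS' : (3 : ℝ) ^ 2 < (3 * e) ^ 2 + (3 * e) * (3 * τ) + (3 * τ) ^ 2 / 3 := by linarith
  by_cases h1 : 3 * e ≤ 78 / 100
  · have hb := le_of_quadratic (b₀ := 398 / 100) (by positivity) (by positivity) h1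
      (by norm_num) hS'
    refine h.frickeSum_ne_zero_of_small_e (m₀ := 3) (P := 142 / 100) (e₀ := 0) (τ₀ := 398 / 300)
      hpos (by linarith) le_rfl le_rfl (by norm_num) ?_ le_rfl (by norm_num)
      (by push_cast; linarith) (by push_cast; linarith) ?_
    · calc (1 + e) ^ 3 ≤ (1 + 26 / 100) ^ 3 := by gcongr; linarith
        _ ≤ _ := by norm_num
    · norm_num [imRemainderBound, remainderBound]
  by_cases h2 : 3 * e ≤ 196 / 100
  · have hb := le_of_quadratic (b₀ := 197 / 100) (by positivity) (by positivity) h2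
      (by norm_num) hS'
    refine h.frickeSum_ne_zero_of_large_e (m₀ := 3) (e₀ := 26 / 100) (τ₀ := 197 / 300)
      le_rfl le_rfl (by norm_num) (by norm_num) (by push_cast; linarith) (by push_cast; linarith) ?_
    norm_num [remainderBound]
  · refine h.frickeSum_ne_zero_of_large_e (m₀ := 3) (e₀ := 196 / 300) (τ₀ := 0)
      le_rfl le_rfl (by norm_num) le_rfl (by push_cast; linarith) (by push_cast; linarith) ?_
    norm_num [remainderBound]

lemma one_add_pow_le_of_exp_le {x a B : ℝ} (hx : 0 ≤ x) (h : m * x ≤ a) (hB : Real.exp a ≤ B) :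
    (1 + x) ^ m ≤ B := by
  calc (1 + x) ^ m ≤ (Real.exp x) ^ m := by
        gcongr; linarith [Real.add_one_le_exp x]
    _ = Real.exp (m * x) := by rw [← Real.exp_nat_mul]
    _ ≤ Real.exp a := Real.exp_le_exp.2 h
    _ ≤ B := hB

/-- The last coefficient is the remainder bound `7/(6! · 6)` on `[0, 1]`. -/
lemma exp_le_of_taylor {a B : ℝ} (h0 : 0 ≤ a) (h1 : a ≤ 1)
    (h : 1 + a + a ^ 2 / 2 + a ^ 3 / 6 + a ^ 4 / 24 + a ^ 5 / 120 + a ^ 6 * 7 / 4320 ≤ B) :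
    Real.exp a ≤ B := by
  refine (Real.exp_bound' h0 h1 (n := 6) (by norm_num)).trans (le_trans (le_of_eq ?_) h)
  simp only [Finset.sum_range_succ, Finset.sum_range_zero]
  norm_num [Nat.factorial]

/-- The range of `m e` is cut into cells `[a₀, a₁]`, each with its forced bound `b₀ ≤ m τ`, and
every cell is checked at `m = 4`. The imaginary-part method serves up to `57/100` and absolute
values beyond; past `132/100` no information on `τ` is needed. -/
theorem frickeSum_ne_zero_away_corner (h : DomainCoords s e τ) (hpos : 0 < e) (hm : 4 ≤ m)
    (hS : (29 / 20 : ℝ) ^ 2 < m ^ 2 * (e ^ 2 + e * τ + τ ^ 2 / 3)) : frickeSum (2 * m) s ≠ 0 := by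
  have ht := h.τ_nonneg
  have hm4 : (4 : ℝ) ≤ m := by exact_mod_cast hm
  have hS' : (29 / 20 : ℝ) ^ 2 < (m * e) ^ 2 + (m * e) * (m * τ) + (m * τ) ^ 2 / 3 := by linarith
  have ha0 : 0 ≤ m * e := by positivity
  have hb0 : 0 ≤ m * τ := by positivity
  -- With `m ≥ 4`, the cap `8/7` yields `e ≤ 2/7`; `P` bounds `R` through `(1 + e)ᵐ ≤ exp (m e)`.
  have small : ∀ {a₀ a₁ b₀ P : ℝ}, 0 ≤ a₀ → 0 ≤ b₀ → a₀ ≤ m * e → m * e ≤ a₁ → a₁ ≤ 8 / 7 →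
      a₁ ^ 2 + a₁ * b₀ + b₀ ^ 2 / 3 ≤ (29 / 20) ^ 2 → Real.exp a₁ ≤ P ^ 2 → 0 ≤ P →
      (P * imRemainderBound 4 (a₀ / 4) (b₀ / 4)) ^ 2 +
        (remainderBound 4 (a₀ / 4) (b₀ / 4) * (P ^ 2 / (P ^ 2 + 1))) ^ 2 < 1 →
      frickeSum (2 * m) s ≠ 0 := by
    intro a₀ a₁ b₀ P h1 h2 h3 h4 h5 h6 h7 h8 h9
    have hb := le_of_quadratic ha0 hb0 h4 h6 hS'
    exact h.frickeSum_ne_zero_of_small_e hpos (by nlinarith) (by norm_num) hm h8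
      (one_add_pow_le_of_exp_le hpos.le h4 h7) (by positivity) (by positivity)
      (by push_cast; linarith) (by push_cast; linarith) h9
  have large : ∀ {a₀ a₁ b₀ : ℝ}, 0 ≤ a₀ → 0 ≤ b₀ → a₀ ≤ m * e → m * e ≤ a₁ →
      a₁ ^ 2 + a₁ * b₀ + b₀ ^ 2 / 3 ≤ (29 / 20) ^ 2 →
      ((1 + a₀ / 4) ^ 4)⁻¹ + remainderBound 4 (a₀ / 4) (b₀ / 4) < 1 →
      frickeSum (2 * m) s ≠ 0 := by
    intro a₀ a₁ b₀ h1 h2 h3 h4 h6 h9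
    have hb := le_of_quadratic ha0 hb0 h4 h6 hS'
    exact h.frickeSum_ne_zero_of_large_e (by norm_num) hm (by positivity) (by positivity)
      (by push_cast; linarith) (by push_cast; linarith) h9
  by_cases c1 : m * e ≤ 31 / 100
  · exact small (a₀ := 0) (b₀ := 203 / 100) (P := 117 / 100) le_rfl (by norm_num) ha0 c1
      (by norm_num) (by norm_num) (exp_le_of_taylor (by norm_num) (by norm_num) (by norm_num))
      (by norm_num) (by norm_num [imRemainderBound, remainderBound])
  by_cases c2 : m * e ≤ 48 / 100
  · exact small (a₀ := 31 / 100) (b₀ := 175 / 100) (P := 128 / 100) (by norm_num) (by norm_num)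
      (not_le.1 c1).le c2
      (by norm_num) (by norm_num) (exp_le_of_taylor (by norm_num) (by norm_num) (by norm_num))
      (by norm_num) (by norm_num [imRemainderBound, remainderBound])
  by_cases c3 : m * e ≤ 57 / 100
  · exact small (a₀ := 48 / 100) (b₀ := 160 / 100) (P := 133 / 100) (by norm_num) (by norm_num)
      (not_le.1 c2).le c3
      (by norm_num) (by norm_num) (exp_le_of_taylor (by norm_num) (by norm_num) (by norm_num))
      (by norm_num) (by norm_num [imRemainderBound, remainderBound])
  by_cases c4 : m * e ≤ 64 / 100
  · exact large (a₀ := 57 / 100) (b₀ := 148 / 100) (by norm_num) (by norm_num)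
      (not_le.1 c3).le c4 (by norm_num) (by norm_num [remainderBound])
  by_cases c5 : m * e ≤ 78 / 100
  · exact large (a₀ := 64 / 100) (b₀ := 124 / 100) (by norm_num) (by norm_num)
      (not_le.1 c4).le c5 (by norm_num) (by norm_num [remainderBound])
  by_cases c6 : m * e ≤ 102 / 100
  · exact large (a₀ := 78 / 100) (b₀ := 82 / 100) (by norm_num) (by norm_num)
      (not_le.1 c5).le c6 (by norm_num) (by norm_num [remainderBound])
  by_cases c7 : m * e ≤ 132 / 100
  · exact large (a₀ := 102 / 100) (b₀ := 25 / 100) (by norm_num) (by norm_num)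
      (not_le.1 c6).le c7 (by norm_num) (by norm_num [remainderBound])
  · exact h.frickeSum_ne_zero_of_large_e (m₀ := 4) (e₀ := 33 / 100) (τ₀ := 0) (by norm_num) hm
      (by norm_num) le_rfl (by push_cast; linarith [not_le.1 c7]) (by push_cast; linarith)
      (by norm_num [remainderBound])

theorem frickeSum_ne_zero (h : DomainCoords s e τ) (hpos : 0 < e) (hm : 3 ≤ m) :
    frickeSum (2 * m) s ≠ 0 := by
  rcases hm.eq_or_lt with rfl | hm4
  · by_cases hS : (3 : ℝ) ^ 2 * (e ^ 2 + e * τ + τ ^ 2 / 3) ≤ 3 ^ 2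
    · exact frickeSum_three_ne_zero_near_corner h hpos hS
    · exact h.frickeSum_three_ne_zero_away_corner hpos (not_le.1 hS)
  · by_cases hS : (m : ℝ) ^ 2 * (e ^ 2 + e * τ + τ ^ 2 / 3) ≤ (29 / 20) ^ 2
    · exact frickeSum_ne_zero_near_corner hm4 h hpos hS
    · exact h.frickeSum_ne_zero_away_corner hpos hm4 (not_le.1 hS)

end DomainCoords

/-! ### Weight four high in the strip. -/

lemma norm_tsum_sigma_three_le {q : ℂ} {x : ℝ} (hq : ‖q‖ ≤ x) (hx : 16 * x < 1) :
    ‖∑' n : ℕ+, (ArithmeticFunction.sigma 3 n : ℂ) * q ^ (n : ℤ)‖ ≤ x / (1 - 16 * x) := by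
  have hx0 : 0 ≤ x := (norm_nonneg q).trans hq
  simp_rw [zpow_natCast]
  rw [tsum_pnat_eq_tsum_succ (f := fun n : ℕ => (ArithmeticFunction.sigma 3 n : ℂ) * q ^ n)]
  refine tsum_of_norm_bounded (g := fun n : ℕ => x * (16 * x) ^ n) ?_ fun n => ?_
  · rw [div_eq_mul_inv]
    exact (hasSum_geometric_of_lt_one (by positivity) hx).mul_left x
  · have h1 : ArithmeticFunction.sigma 3 (n + 1) ≤ 16 ^ n := by
      calc ArithmeticFunction.sigma 3 (n + 1) ≤ (n + 1) ^ (3 + 1) :=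
            ArithmeticFunction.sigma_le_pow_succ 3 (n + 1)
        _ ≤ (2 ^ n) ^ 4 := Nat.pow_le_pow_left Nat.lt_two_pow_self 4
        _ = 16 ^ n := by rw [← pow_mul, mul_comm, pow_mul]; norm_num
    have h2 : (ArithmeticFunction.sigma 3 (n + 1) : ℝ) ≤ 16 ^ n := by exact_mod_cast h1
    rw [norm_mul, norm_pow, Complex.norm_natCast]
    calc (ArithmeticFunction.sigma 3 (n + 1) : ℝ) * ‖q‖ ^ (n + 1) ≤ 16 ^ n * x ^ (n + 1) := by
          gcongr
      _ = x * (16 * x) ^ n := by rw [mul_pow]; ring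

lemma eisenstein_four_eq (z : ℍ) (h : 3 ≤ 4) : ModularForm.E (k := 4) h z =
    1 + 240 * ∑' n : ℕ+, (ArithmeticFunction.sigma 3 n : ℂ) *
      Complex.exp (2 * Real.pi * Complex.I * z) ^ (n : ℤ) := by
  rw [EisensteinSeries.q_expansion_bernoulli h (by decide) z]
  have : bernoulli 4 = -1 / 30 := by
    rw [bernoulli_eq_bernoulli'_of_ne_one (by norm_num), bernoulli'_four]
  rw [this]
  push_cast
  norm_num

lemma norm_exp_two_pi_I_mul (w : ℂ) :
    ‖Complex.exp (2 * Real.pi * Complex.I * w)‖ = Real.exp (-(2 * Real.pi * w.im)) := by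
  rw [Complex.norm_exp]
  congr 1
  simp

/-- Here `2π Im z ≥ 4`, so `|q| ≤ e⁻⁴ ≤ 1/50`. The series is `1 + 24 ∑ σ₃(n) qⁿ + 216 ∑ σ₃(n) q³ⁿ`,
and the two sums together stay below 1. -/
lemma frickeEisenstein_four_ne_zero (z : ℍ) (hz : 6 / 5 < √3 * z.im) :
    frickeEisenstein 3 4 le_rfl z ≠ 0 := by
  intro h0
  set q := Complex.exp (2 * Real.pi * Complex.I * z) with hq
  have h4 : 4 ≤ 2 * Real.pi * z.im := by
    have h1 : √3 < 1.74 := by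
      rw [Real.sqrt_lt' (by norm_num)]; norm_num
    have h2 : (6 / 5 : ℝ) < 1.74 * z.im := hz.trans_le (by gcongr)
    nlinarith [Real.pi_gt_d2, z.im_pos]
  have hq1 : ‖q‖ ≤ 1 / 50 := by
    rw [hq, norm_exp_two_pi_I_mul, Real.exp_neg, one_div]
    have he : (50 : ℝ) ≤ Real.exp 4 := by
      have := Real.exp_one_gt_d9
      calc (50 : ℝ) ≤ 2.7182818283 ^ 4 := by norm_num
        _ ≤ Real.exp 1 ^ 4 := by gcongr
        _ = Real.exp 4 := by rw [← Real.exp_nat_mul]; norm_num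
    gcongr
    exact he.trans (Real.exp_le_exp.2 h4)
  set z3 := (⟨((3 : ℕ) : ℝ), Nat.cast_pos.mpr (NeZero.pos 3)⟩ : {x : ℝ // 0 < x}) • z with hz3
  have hz3c : (z3 : ℂ) = 3 * (z : ℂ) := by
    rw [hz3, UpperHalfPlane.coe_pos_real_smul]; simp
  have hq3 : Complex.exp (2 * Real.pi * Complex.I * z3) = q ^ 3 := by
    rw [hz3c, hq, ← Complex.exp_nat_mul]
    congr 1
    push_cast
    ring
  have b1 := norm_tsum_sigma_three_le hq1 (by norm_num)
  have b3 : ‖∑' n : ℕ+, (ArithmeticFunction.sigma 3 n : ℂ) * (q ^ 3) ^ (n : ℤ)‖ ≤ _ :=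
    norm_tsum_sigma_three_le (x := (1 / 50) ^ 3) (by rw [norm_pow]; gcongr) (by norm_num)
  rw [frickeEisenstein, eisenstein_four_eq, eisenstein_four_eq, hq3] at h0
  set S := ∑' n : ℕ+, (ArithmeticFunction.sigma 3 n : ℂ) * q ^ (n : ℤ)
  set T := ∑' n : ℕ+, (ArithmeticFunction.sigma 3 n : ℂ) * (q ^ 3) ^ (n : ℤ)
  norm_num at h0
  have h1 : (1 : ℂ) = -(216 * T + 24 * S) := by linear_combination h0 / 10
  have h2 := congrArg norm h1
  rw [norm_one, norm_neg] at h2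
  have h3 := norm_add_le (216 * T) (24 * S)
  rw [norm_mul, norm_mul] at h3
  norm_num at h3 b1 b3
  linarith

/-! ### Reflection to the right half and conclusion. -/

/-- Reindexing by `(a, b) ↦ (-a, b)` conjugates each form up to a sign, which the even exponent
removes. -/
lemma frickeSum_neg_conj {m : ℕ} (s : ℂ) :
    frickeSum (2 * m) (-conj s) = conj (frickeSum (2 * m) s) := by
  rw [frickeSum, frickeSum, Complex.conj_tsum,
    ← ((Equiv.neg ℤ).prodCongr (Equiv.refl ℤ)).tsum_eq]
  refine tsum_congr fun p => ?_
  have hterm : frickeTerm (2 * m) (-conj s) (-p.1, p.2) = conj (frickeTerm (2 * m) s p) := by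
    have h1 : linForm (-conj s) (-p.1, p.2) = conj (linForm s p) := by
      simp [linForm]
    have h2 : dualForm (-conj s) (-p.1, p.2) = -conj (dualForm s p) := by
      simp [dualForm]; ring
    rw [frickeTerm, h1, h2, (even_two_mul m).neg_pow]
    simp [frickeTerm]
  by_cases hp : p ∈ admissiblePairs
  · rw [Set.indicator_of_mem hp, Set.indicator_of_mem]
    · exact hterm
    · exact ⟨hp.1.neg_left, hp.2⟩
  · rw [Set.indicator_of_notMem hp, Set.indicator_of_notMem, map_zero]
    exact fun h => hp ⟨by simpa using h.1.neg_left, h.2⟩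

lemma sqrt_three_mul_domainCoords {z : ℂ} (him : 0 < z.im) (hz : 1 / √3 < ‖z‖)
    (hre : -(1 / 2) ≤ z.re) (hre' : z.re ≤ 0) :
    0 < 3 * ‖z‖ ^ 2 - 1 ∧
      DomainCoords ((√3 : ℝ) * z) (3 * ‖z‖ ^ 2 - 1) (3 + 6 * z.re) := by
  have h3 : √3 ^ 2 = 3 := Real.sq_sqrt (by norm_num)
  have h3' : 0 < √3 := by positivity
  have hpos : 0 < 3 * ‖z‖ ^ 2 - 1 := by
    have h1 : 1 < ‖z‖ * √3 := (div_lt_iff₀ h3').1 hz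
    have h2 : 1 < (‖z‖ * √3) ^ 2 := one_lt_pow₀ h1 (by norm_num)
    rw [mul_pow, h3] at h2
    linarith
  refine ⟨hpos, ?_, hpos.le, by linarith, by linarith, ?_, ?_⟩
  · rw [Complex.im_ofReal_mul]; positivity
  · rw [Complex.im_ofReal_mul, Complex.re_ofReal_mul, ← Complex.normSq_eq_norm_sq,
      Complex.normSq_apply]
    linear_combination (z.re ^ 2 + z.im ^ 2) * h3
  · rw [Complex.re_ofReal_mul]
    linear_combination z.re * h3

lemma frickeSum_ne_zero_of_re_nonpos {m : ℕ} (hm : 2 ≤ m) {z : ℂ} (him : 0 < z.im)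
    (hz : 1 / √3 < ‖z‖) (hre : -(1 / 2) ≤ z.re) (hre' : z.re ≤ 0) :
    frickeSum (2 * m) ((√3 : ℝ) * z) ≠ 0 := by
  obtain ⟨hpos, h⟩ := sqrt_three_mul_domainCoords him hz hre hre'
  rcases hm.eq_or_lt with rfl | hm3
  · rcases le_or_gt (((√3 : ℝ) * z).im) (6 / 5) with hle | hgt
    · exact frickeSum_two_ne_zero_near_corner h hpos hle
    · have := frickeEisenstein_four_ne_zero ⟨z, him⟩ (by rwa [Complex.im_ofReal_mul] at hgt)
      exact fun h0 => this (by
        rw [frickeEisenstein_eq_frickeSum (m := 2) (by norm_num)]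
        exact mul_eq_zero_of_right _ h0)
  · exact h.frickeSum_ne_zero hpos hm3

lemma frickeSum_ne_zero_of_norm_gt {m : ℕ} (hm : 2 ≤ m) {z : ℂ} (him : 0 < z.im)
    (hz : 1 / √3 < ‖z‖) (hre : |z.re| ≤ 1 / 2) : frickeSum (2 * m) ((√3 : ℝ) * z) ≠ 0 := by
  obtain ⟨h1, h2⟩ := abs_le.1 hre
  rcases le_total z.re 0 with h | h
  · exact frickeSum_ne_zero_of_re_nonpos hm him hz h1 h
  · have key := frickeSum_ne_zero_of_re_nonpos hm (z := -conj z) (by simpa using him)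
      (by simpa using hz) (by simpa using h2) (by simpa using h)
    rw [show ((√3 : ℝ) : ℂ) * -conj z = -conj (((√3 : ℝ) : ℂ) * z) by simp,
      frickeSum_neg_conj] at key
    exact fun h0 => key (by rw [h0, map_zero])

lemma arg_mem_of_norm_eq {z : ℂ} (him : 0 < z.im) (hz : ‖z‖ = 1 / √3) (hre : -(1 / 2) ≤ z.re)
    (hre' : z.re ≤ 0) : Real.pi / 2 ≤ z.arg ∧ z.arg ≤ 5 * Real.pi / 6 := by
  have h3' : 0 < √3 := by positivity
  refine ⟨not_lt.1 fun h => ?_, ?_⟩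
  · rcases Complex.arg_lt_pi_div_two_iff.1 h with h | h | rfl
    · linarith
    · linarith
    · simp at him
  have hz0 : z ≠ 0 := fun h => by simp [h] at him
  by_contra! hlt
  have hcos := Real.cos_lt_cos_of_nonneg_of_le_pi (by positivity) (Complex.arg_le_pi z) hlt
  have h56 : Real.cos (5 * Real.pi / 6) = -(√3 / 2) := by
    rw [show 5 * Real.pi / 6 = Real.pi - Real.pi / 6 by ring, Real.cos_pi_sub, Real.cos_pi_div_six]
  rw [Complex.cos_arg hz0, h56, hz, div_div_eq_mul_div, div_one] at hcos
  nlinarith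

theorem theorem2 (k : ℕ) (hk : 4 ≤ k) (hkeven : Even k) (z : UpperHalfPlane)
    (hz : z ∈ frickeDomainThree) (hzero : frickeEisenstein 3 k hk z = 0) :
    (z : ℂ) ∈ frickeClosedArcThree := by
  obtain ⟨m, rfl⟩ := hkeven.two_dvd
  rw [frickeEisenstein_eq_frickeSum hk z] at hzero
  have hsum : frickeSum (2 * m) ((√3 : ℝ) * z) = 0 :=
    (mul_eq_zero.1 hzero).resolve_left (by norm_num)
  have hnot : 1 / √3 < ‖(z : ℂ)‖ → ¬ |z.re| ≤ 1 / 2 := fun h1 h2 =>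
    frickeSum_ne_zero_of_norm_gt (by omega) z.im_pos h1 h2 hsum
  rcases hz with ⟨h1, h2, h3⟩ | ⟨h1, h2, h3⟩
  · rcases h1.eq_or_lt with h | h
    · exact ⟨h.symm, arg_mem_of_norm_eq z.im_pos h.symm h2 h3⟩
    · exact absurd (abs_le.2 ⟨h2, by linarith⟩) (hnot h)
  · exact absurd (abs_le.2 ⟨by linarith, h3.le⟩) (hnot h1)
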